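/- Let $Pr$ be a set of primitive types with a function $type: Pr\to\mathbb N$. \textbf{Graphs.} A (hyper)graph $G=\langle V,E,att,lab,ext\rangle$ over a set $X$ of labels with a function $type:X\to\mathbb N$ consists of finite sets $V$ of nodes and $E$ of edges, a string $att(e)$ of pairwise distinct nodes for each $e\in E$, a label $lab(e)\in X$ with $type(lab(e))=|att(e)|$ for each $e\in E$, and a string $ext$ of pairwise distinct (external) nodes; $type(G):=|ext|$. Isomorphic graphs are not distinguished. The handle $a^\bullet$ has $type(a)$ nodes $v_1,\dots,v_n$ and one edge labelled $a$ with $att=ext=v_1\dots v_n$. For a nonempty string $w=a_1\dots a_n$ of labels of type $2$, the string graph $w^\bullet$ has nodes $v_0,\dots,v_n$, edges $e_1,\dots,e_n$ with $att(e_i)=v_{i-1}v_i$ and $lab(e_i)=a_i$, and $ext=v_0v_n$. For distinct edges $e_1,\dots,e_k$ of $G$ and graphs $H_i$ with $type(H_i)=|att_G(e_i)|$, the graph $G[e_1/H_1,\dots,e_k/H_k]$ is obtained by removing the edges $e_i$, inserting disjoint copies of the $H_i$, and fusing the $j$-th external node of $H_i$ with the $j$-th attachment node of $e_i$. \textbf{The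 hypergraph Lambek calculus $\mathrm{HL}$.} $Tp(\mathrm{HL})$ is the least set such that: $Pr\subseteq Tp(\mathrm{HL})$; if $N\in Tp(\mathrm{HL})$ and $D$ is a graph with $type(D)=type(N)$ in which exactly one edge $d_0$ is labelled by a special symbol $\$$ and all other edges are labelled by elements of $Tp(\mathrm{HL})$, then $N\div D\in Tp(\mathrm{HL})$, with $type(N\div D):=|att_D(d_0)|$; if $M$ is a graph labelled by elements of $Tp(\mathrm{HL})$, then $\times(M)\in Tp(\mathrm{HL})$, with $type(\times(M)):=type(M)$. A graph sequent $H\to A$ consists of a graph $H$ labelled by types and a type $A$ with $type(H)=type(A)$. Derivability $\mathrm{HL}\vdash H\to A$ is given by the axioms $p^\bullet\to p$ ($p\in Pr$) and the following rules (for graph sequents, whenever the replacements are defined): \begin{itemize} \item $(\div\to)$: if $lab_H(e)=N$ and $d_0,\dots,d_k$ are the edges of $D$, with $lab(d_0)=\$$, then from $H\to A$ and $H_i\to lab(d_i)$ $(1\le i\le k)$ infer $H[e/D][d_0:=N\div D][d_1/H_1,\dots,d_k/H_k]\to A$, where $[d_0:=N\div D]$ means relabelling $d_0$; \item $(\to\div)$: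 from $D[d_0/F]\to N$, where $d_0$ is the $\$$-labelled edge of $D$, infer $F\to N\div D$; \item $(\times\to)$: if $lab_G(e)=\times(F)$, then from $G[e/F]\to A$ infer $G\to A$; \item $(\to\times)$: if $m_1,\dots,m_l$ ($l\ge 0$) are the edges of $M$, then from $H_i\to lab(m_i)$ $(1\le i\le l)$ infer $M[m_1/H_1,\dots,m_l/H_l]\to\times(M)$. \end{itemize} \textbf{The Lambek calculus $\mathrm{L}$.} $Tp(\mathrm{L})$ is built from the primitive types $p\in Pr$ with $type(p)=2$ by the binary connectives $B\backslash A$, $A/B$, $A\cdot B$. A sequent $\Gamma\to C$ consists of a nonempty finite sequence $\Gamma$ of types and a type $C$. The axioms are $p\to p$ for primitive $p$, and the rules are, with $\Pi,\Psi$ nonempty: from $\Pi\to A$ and $\Gamma,B,\Delta\to C$ infer $\Gamma,\Pi,A\backslash B,\Delta\to C$ and infer $\Gamma,B/A,\Pi,\Delta\to C$; from $A,\Pi\to B$ infer $\Pi\to A\backslash B$; from $\Pi,A\to B$ infer $\Pi\to B/A$; from $\Gamma,A,B,\Delta\to C$ infer $\Gamma,A\cdot B,\Delta\to C$; from $\Pi\to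 A$ and $\Psi\to B$ infer $\Pi,\Psi\to A\cdot B$. \textbf{The translation.} Define $tr:Tp(\mathrm{L})\to Tp(\mathrm{HL})$ by $tr(p):=p$, $tr(A/B):=tr(A)\div(\$\,tr(B))^\bullet$, $tr(B\backslash A):=tr(A)\div(tr(B)\,\$)^\bullet$, $tr(A\cdot B):=\times((tr(A)\,tr(B))^\bullet)$, where $\$$ is used here with type $2$; and put $tr(A_1,\dots,A_n\to C):=(tr(A_1)\dots tr(A_n))^\bullet\to tr(C)$ for $n\geq 1$. Let $tr(Tp(\mathrm{L}))$ be the image of $tr$. \textbf{Theorem.} \begin{enumerate} \item If $\mathrm{L}\vdash\Gamma\to C$, then $\mathrm{HL}\vdash tr(\Gamma\to C)$. \item If $\mathrm{HL}\vdash G\to T$ is a derivable graph sequent such that all edge labels of $G$ and the type $T$ belong to $tr(Tp(\mathrm{L}))$, then there are $\Gamma$ (nonempty) and $C$ such that $G\to T=tr(\Gamma\to C)$ (in particular, $G$ is a string graph) and $\mathrm{L}\vdash\Gamma\to C$. \end{enumerate} -/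

import Mathlib

/-! ## The Lambek calculus `L` -/

/-- Types of the Lambek calculus over a set `P` of primitive types. -/
inductive LTp (P : Type) : Type where
  | prim (p : P) : LTp P
  /-- `under B A` is `B \ A`. -/
  | under (B A : LTp P) : LTp P
  /-- `over A B` is `A / B`. -/
  | over (A B : LTp P) : LTp P
  /-- `mul A B` is `A · B`. -/
  | mul (A B : LTp P) : LTp P

/-- `LDerivable Γ C` means `L ⊢ Γ → C`. -/
inductive LDerivable {P : Type} : List (LTp P) → LTp P → Prop where
  | ax (p : P) : LDerivable [LTp.prim p] (LTp.prim p)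
  | underL (Γ Θ Δ : List (LTp P)) (A B C : LTp P) (hΘ : Θ ≠ []) :
      LDerivable Θ A → LDerivable (Γ ++ [B] ++ Δ) C →
      LDerivable (Γ ++ Θ ++ [LTp.under A B] ++ Δ) C
  | underR (Θ : List (LTp P)) (A B : LTp P) (hΘ : Θ ≠ []) :
      LDerivable ([A] ++ Θ) B → LDerivable Θ (LTp.under A B)
  | mulL (Γ Δ : List (LTp P)) (A B C : LTp P) :
      LDerivable (Γ ++ [A, B] ++ Δ) C → LDerivable (Γ ++ [LTp.mul A B] ++ Δ) C
  | overL (Γ Θ Δ : List (LTp P)) (A B C : LTp P) (hΘ : Θ ≠ []) :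
      LDerivable Θ A → LDerivable (Γ ++ [B] ++ Δ) C →
      LDerivable (Γ ++ [LTp.over B A] ++ Θ ++ Δ) C
  | overR (Θ : List (LTp P)) (A B : LTp P) (hΘ : Θ ≠ []) :
      LDerivable (Θ ++ [A]) B → LDerivable Θ (LTp.over B A)
  | mulR (Θ Ψ : List (LTp P)) (A B : LTp P) (hΘ : Θ ≠ []) (hΨ : Ψ ≠ []) :
      LDerivable Θ A → LDerivable Ψ B → LDerivable (Θ ++ Ψ) (LTp.mul A B)

/-! ## Hypergraphs -/

/-- A finite hypergraph with labels in `C`, where `ty` is the type function on `C`. Strings of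
distinct nodes are repetition-free lists. -/
structure HGraph {C : Type 1} (ty : C → ℕ) : Type 1 where
  V : Type
  E : Type
  finV : Finite V
  finE : Finite E
  att : E → List V
  att_nodup : ∀ e, (att e).Nodup
  lab : E → C
  lab_type : ∀ e, ty (lab e) = (att e).length
  ext : List V
  ext_nodup : ext.Nodup

/-- A graph `D` in which exactly one edge `e₀` is labelled by `$` and all other edges are labelled
by elements of `C`. The inherited field `E` is the set of edges other than `e₀` (so that the full
edge set is `Option E`, with `none` standing for `e₀`), and `att₀` is the string of attachment
nodes of `e₀`. -/
structure Denom {C : Type 1} (ty : C → ℕ) : Type 1 extends HGraph ty where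
  att₀ : List V
  att₀_nodup : att₀.Nodup

namespace HGraph

variable {C : Type 1} {ty : C → ℕ}

/-- The type of a graph: the number of its external nodes. -/
def type (G : HGraph ty) : ℕ := G.ext.length

/-- Two graphs are isomorphic. -/
def Iso (G H : HGraph ty) : Prop :=
  ∃ (ν : G.V ≃ H.V) (ε : G.E ≃ H.E),
    (∀ e, H.att (ε e) = (G.att e).map ν) ∧ (∀ e, H.lab (ε e) = G.lab e) ∧
      H.ext = G.ext.map ν

/-- The handle `a^•`. -/
def handle (ty : C → ℕ) (a : C) : HGraph ty where
  V := Fin (ty a)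
  E := Unit
  finV := inferInstance
  finE := inferInstance
  att _ := List.finRange (ty a)
  att_nodup _ := List.nodup_finRange _
  lab _ := a
  lab_type _ := (List.length_finRange).symm
  ext := List.finRange (ty a)
  ext_nodup := List.nodup_finRange _

/-- The string graph `w^•` induced by a nonempty string `w` of labels of type `2`. -/
def str (w : List {c : C // ty c = 2}) (hw : w ≠ []) : HGraph ty where
  V := Fin (w.length + 1)
  E := Fin w.length
  finV := inferInstance
  finE := inferInstance
  att i := [i.castSucc, i.succ]
  att_nodup i := by simp [Fin.ext_iff]
  lab i := (w.get i).1
  lab_type i := (w.get i).2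
  ext := [0, Fin.last w.length]
  ext_nodup := by
    have : w.length ≠ 0 := fun h => hw (List.length_eq_zero_iff.1 h)
    simpa [Fin.ext_iff] using this.symm

section Replace

variable (G : HGraph ty) {ι : Type} (f : ι ↪ G.E) (K : ι → HGraph ty)
  (h : ∀ i, (K i).type = (G.att (f i)).length)

/-- Nodes of `G[f i / K i]`: the nodes of `G` and the non-external nodes of all the `K i`. -/
abbrev ReplaceV : Type := G.V ⊕ (Σ i, {v : (K i).V // v ∉ (K i).ext})

open Classical in
/-- Where a node of `K i` goes in `G[f i / K i]`: the `j`-th external node of `K i` is fused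
with the `j`-th attachment node of the edge `f i`. -/
noncomputable def replaceNode (i : ι) (v : (K i).V) : ReplaceV G K :=
  if hv : v ∈ (K i).ext then
    Sum.inl ((G.att (f i)).get ⟨(K i).ext.idxOf v, h i ▸ List.idxOf_lt_length_of_mem hv⟩)
  else Sum.inr ⟨i, v, hv⟩

theorem replaceNode_injective (i : ι) : Function.Injective (replaceNode G f K h i) := by
  classical
  intro v w hvw
  unfold replaceNode at hvw
  split_ifs at hvw with hv hw hw
  · have h1 := Sum.inl.inj hvw
    have h2 := (List.Nodup.get_inj_iff (G.att_nodup (f i))).1 h1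
    exact (List.idxOf_inj hv).1 (Fin.mk.inj h2)
  · have h1 := Sum.inr.inj hvw
    simpa using h1

/-- Simultaneous hyperedge replacement `G[f i / K i]_i` of the distinct edges `f i` of `G` by the
graphs `K i`. -/
noncomputable def replace : HGraph ty where
  V := ReplaceV G K
  E := {e : G.E // e ∉ Set.range f} ⊕ (Σ i, (K i).E)
  finV := by
    have := G.finV
    have := G.finE
    have : Finite ι := Finite.of_injective f f.injective
    have := fun i => (K i).finV
    infer_instance
  finE := by
    have := G.finE
    have : Finite ι := Finite.of_injective f f.injective
    have := fun i => (K i).finE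
    infer_instance
  att := Sum.elim (fun e => (G.att e.1).map Sum.inl)
    (fun x => ((K x.1).att x.2).map (replaceNode G f K h x.1))
  att_nodup := by
    rintro (e | ⟨i, e⟩)
    · exact (G.att_nodup e.1).map Sum.inl_injective
    · exact ((K i).att_nodup e).map (replaceNode_injective G f K h i)
  lab := Sum.elim (fun e => G.lab e.1) (fun x => (K x.1).lab x.2)
  lab_type := by
    rintro (e | ⟨i, e⟩)
    · simpa using G.lab_type e.1
    · simpa using (K i).lab_type e
  ext := G.ext.map Sum.inl
  ext_nodup := G.ext_nodup.map Sum.inl_injective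

end Replace

/-- Replacement `G[e/H]` of a single edge. -/
noncomputable def replaceOne (G : HGraph ty) (e : G.E) (H : HGraph ty)
    (h : H.type = (G.att e).length) : HGraph ty :=
  G.replace (ι := Unit) ⟨fun _ => e, fun _ _ _ => rfl⟩ (fun _ => H) (fun _ => h)

/-- Replacement `G[m/H_m]_m` of all the edges of `G`. -/
noncomputable def replaceAll (G : HGraph ty) (H : G.E → HGraph ty)
    (h : ∀ m, (H m).type = (G.att m).length) : HGraph ty :=
  G.replace (Function.Embedding.refl G.E) H h

end HGraph

namespace Denom

variable {C : Type 1} {ty : C → ℕ}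

/-- `D[e₀ := a]`. -/
def fill (D : Denom ty) (a : C) (ha : ty a = D.att₀.length) : HGraph ty where
  V := D.V
  E := Option D.E
  finV := D.finV
  finE := by have := D.finE; infer_instance
  att o := o.elim D.att₀ D.att
  att_nodup := by
    rintro (_ | e)
    · exact D.att₀_nodup
    · exact D.att_nodup e
  lab o := o.elim a D.lab
  lab_type := by
    rintro (_ | e)
    · exact ha
    · exact D.lab_type e
  ext := D.ext
  ext_nodup := D.ext_nodup

/-- Isomorphism of graphs with a single `$`-labelled edge. -/
def Iso (D D' : Denom ty) : Prop :=
  ∃ (ν : D.V ≃ D'.V) (ε : D.E ≃ D'.E),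
    (∀ e, D'.att (ε e) = (D.att e).map ν) ∧ (∀ e, D'.lab (ε e) = D.lab e) ∧
      D'.ext = D.ext.map ν ∧ D'.att₀ = D.att₀.map ν

/-- The string graph `($ b)^•`. -/
def dollarLeft (b : {c : C // ty c = 2}) : Denom ty where
  V := Fin 3
  E := Unit
  finV := inferInstance
  finE := inferInstance
  att _ := [1, 2]
  att_nodup _ := by decide
  lab _ := b.1
  lab_type _ := b.2
  ext := [0, 2]
  ext_nodup := by decide
  att₀ := [0, 1]
  att₀_nodup := by decide

/-- The string graph `(b $)^•`. -/
def dollarRight (b : {c : C // ty c = 2}) : Denom ty where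
  V := Fin 3
  E := Unit
  finV := inferInstance
  finE := inferInstance
  att _ := [0, 1]
  att_nodup _ := by decide
  lab _ := b.1
  lab_type _ := b.2
  ext := [0, 2]
  ext_nodup := by decide
  att₀ := [1, 2]
  att₀_nodup := by decide

end Denom

/-! ## Types of `HL`

Graphs are considered up to isomorphism, also when they occur (at any depth) inside types. So the
set of types is built as a quotient: `PreTp` consists of syntax trees, `PreTp.WF` singles out the
well-formed ones, and `PreTp.Equiv` is hereditary isomorphism. -/

/-- Syntax trees of types. In `div N V E att lab ext att₀`, the denominator has the node set `V`,
the edges `E` besides the `$`-labelled one, and `att₀` is the attachment of the `$`-labelled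
edge. -/
inductive PreTp (Pr : Type) : Type 1 where
  | prim (p : Pr) : PreTp Pr
  | div (N : PreTp Pr) (V E : Type) (att : E → List V) (lab : E → PreTp Pr) (ext : List V)
      (att₀ : List V) : PreTp Pr
  | times (V E : Type) (att : E → List V) (lab : E → PreTp Pr) (ext : List V) : PreTp Pr

namespace PreTp

variable {Pr : Type} (ar : Pr → ℕ)

/-- `type` on types, where `ar` is `type` on primitive types. -/
def type : PreTp Pr → ℕ
  | prim p => ar p
  | div _ _ _ _ _ _ att₀ => att₀.length
  | times _ _ _ _ ext => ext.length

/-- Well-formedness of syntax trees. -/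
def WF : PreTp Pr → Prop
  | prim _ => True
  | div N V E att lab ext att₀ =>
      N.WF ∧ Finite V ∧ Finite E ∧ (∀ e, (att e).Nodup) ∧ (∀ e, (lab e).WF) ∧
        (∀ e, (lab e).type ar = (att e).length) ∧ ext.Nodup ∧ att₀.Nodup ∧
        N.type ar = ext.length
  | times V E att lab ext =>
      Finite V ∧ Finite E ∧ (∀ e, (att e).Nodup) ∧ (∀ e, (lab e).WF) ∧
        (∀ e, (lab e).type ar = (att e).length) ∧ ext.Nodup

/-- Two syntax trees denote the same type if they agree up to isomorphism of all the graphs in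
them. -/
def Equiv : PreTp Pr → PreTp Pr → Prop
  | prim p, prim q => p = q
  | div N V E att lab ext att₀, div N' V' E' att' lab' ext' att₀' =>
      Equiv N N' ∧ ∃ (ν : V ≃ V') (ε : E ≃ E'),
        (∀ e, att' (ε e) = (att e).map ν) ∧ (∀ e, Equiv (lab e) (lab' (ε e))) ∧
          ext' = ext.map ν ∧ att₀' = att₀.map ν
  | times V E att lab ext, times V' E' att' lab' ext' =>
      ∃ (ν : V ≃ V') (ε : E ≃ E'),
        (∀ e, att' (ε e) = (att e).map ν) ∧ (∀ e, Equiv (lab e) (lab' (ε e))) ∧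
          ext' = ext.map ν
  | _, _ => False

theorem Equiv.refl (a : PreTp Pr) : Equiv a a := by
  induction a with
  | prim p => exact rfl
  | div N V E att lab ext att₀ ihN ih =>
      exact ⟨ihN, _root_.Equiv.refl V, _root_.Equiv.refl E, by simp, ih, by simp, by simp⟩
  | times V E att lab ext ih =>
      exact ⟨_root_.Equiv.refl V, _root_.Equiv.refl E, by simp, ih, by simp⟩

theorem Equiv.symm {a b : PreTp Pr} (h : Equiv a b) : Equiv b a := by
  induction a generalizing b with
  | prim p => cases b <;> simp_all [Equiv]
  | div N V E att lab ext att₀ ihN ih =>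
      cases b with
      | div =>
        obtain ⟨hN, ν, ε, h1, h2, h3, h4⟩ := h
        refine ⟨ihN hN, ν.symm, ε.symm, fun e => ?_, fun e => ?_, ?_, ?_⟩
        · have := h1 (ε.symm e)
          simp only [_root_.Equiv.apply_symm_apply] at this
          simp [this]
        · have := ih _ (h2 (ε.symm e))
          simpa using this
        · simp [h3]
        · simp [h4]
      | _ => exact h.elim
  | times V E att lab ext ih =>
      cases b with
      | times =>
        obtain ⟨ν, ε, h1, h2, h3⟩ := h
        refine ⟨ν.symm, ε.symm, fun e => ?_, fun e => ?_, ?_⟩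
        · have := h1 (ε.symm e)
          simp only [_root_.Equiv.apply_symm_apply] at this
          simp [this]
        · have := ih _ (h2 (ε.symm e))
          simpa using this
        · simp [h3]
      | _ => exact h.elim

theorem Equiv.trans {a b c : PreTp Pr} (h : Equiv a b) (h' : Equiv b c) : Equiv a c := by
  induction a generalizing b c with
  | prim p => cases b <;> cases c <;> simp_all [Equiv]
  | div N V E att lab ext att₀ ihN ih =>
      cases b with
      | div =>
        cases c with
        | div =>
          obtain ⟨hN, ν, ε, h1, h2, h3, h4⟩ := h
          obtain ⟨hN', ν', ε', h1', h2', h3', h4'⟩ := h'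
          refine ⟨ihN hN hN', ν.trans ν', ε.trans ε', fun e => ?_,
            fun e => ih _ (h2 e) (h2' (ε e)), ?_, ?_⟩
          · simp [h1, h1']
          · simp [h3, h3']
          · simp [h4, h4']
        | _ => exact h'.elim
      | _ => exact h.elim
  | times V E att lab ext ih =>
      cases b with
      | times =>
        cases c with
        | times =>
          obtain ⟨ν, ε, h1, h2, h3⟩ := h
          obtain ⟨ν', ε', h1', h2', h3'⟩ := h'
          refine ⟨ν.trans ν', ε.trans ε', fun e => ?_,
            fun e => ih _ (h2 e) (h2' (ε e)), ?_⟩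
          · simp [h1, h1']
          · simp [h3, h3']
        | _ => exact h'.elim
      | _ => exact h.elim

theorem Equiv.type_eq {a b : PreTp Pr} (h : Equiv a b) : a.type ar = b.type ar := by
  cases a <;> cases b <;> try exact h.elim
  · exact congrArg ar h
  · obtain ⟨-, ν, ε, -, -, -, h4⟩ := h
    simp [type, h4]
  · obtain ⟨ν, ε, -, -, h3⟩ := h
    simp [type, h3]

/-- Well-formed syntax trees up to hereditary isomorphism. -/
def setoid : Setoid {t : PreTp Pr // t.WF ar} where
  r a b := Equiv a.1 b.1
  iseqv := ⟨fun a => Equiv.refl a.1, fun h => Equiv.symm h, fun h h' => Equiv.trans h h'⟩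

end PreTp

/-- The set `Tp(HL)` of types over the primitive types `Pr` with type function `ar`. -/
def Tp {Pr : Type} (ar : Pr → ℕ) : Type 1 := Quotient (PreTp.setoid ar)

namespace Tp

variable {Pr : Type} {ar : Pr → ℕ}

/-- The function `type` on `Tp(HL)`. -/
def type : Tp ar → ℕ :=
  Quotient.lift (fun t => t.1.type ar) (fun _ _ h => PreTp.Equiv.type_eq ar h)

/-- A syntax tree of a type. -/
noncomputable def rep (t : Tp ar) : PreTp Pr := (Quotient.out t).1

theorem rep_wf (t : Tp ar) : t.rep.WF ar := (Quotient.out t).2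

theorem mk_rep (t : Tp ar) :
    (Quotient.mk (PreTp.setoid ar) ⟨t.rep, t.rep_wf⟩ : Tp ar) = t := Quotient.out_eq t

theorem rep_type (t : Tp ar) : t.rep.type ar = t.type := congrArg Tp.type (mk_rep t)

theorem rep_equiv_rep {s t : Tp ar} : PreTp.Equiv s.rep t.rep ↔ s = t := by
  constructor
  · intro h
    rw [← mk_rep s, ← mk_rep t]
    exact Quotient.sound h
  · rintro rfl
    exact PreTp.Equiv.refl _

/-- Primitive types. -/
def prim (ar : Pr → ℕ) (p : Pr) : Tp ar := Quotient.mk (PreTp.setoid ar) ⟨.prim p, trivial⟩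

/-- The type `N ÷ D`. -/
noncomputable def div (N : Tp ar) (D : Denom (Tp.type (ar := ar))) (h : N.type = D.type) :
    Tp ar :=
  Quotient.mk (PreTp.setoid ar)
    ⟨.div N.rep D.V D.E D.att (fun e => (D.lab e).rep) D.ext D.att₀,
      N.rep_wf, D.finV, D.finE, D.att_nodup, fun e => (D.lab e).rep_wf,
      fun e => (rep_type _).trans (D.lab_type e), D.ext_nodup, D.att₀_nodup,
      (rep_type N).trans h⟩

/-- The type `×(M)`. -/
noncomputable def times (M : HGraph (Tp.type (ar := ar))) : Tp ar :=
  Quotient.mk (PreTp.setoid ar)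
    ⟨.times M.V M.E M.att (fun e => (M.lab e).rep) M.ext,
      M.finV, M.finE, M.att_nodup, fun e => (M.lab e).rep_wf,
      fun e => (rep_type _).trans (M.lab_type e), M.ext_nodup⟩

@[simp] theorem type_prim (p : Pr) : (prim ar p).type = ar p := rfl

@[simp] theorem type_div (N : Tp ar) (D : Denom (Tp.type (ar := ar))) (h : N.type = D.type) :
    (div N D h).type = D.att₀.length := rfl

@[simp] theorem type_times (M : HGraph (Tp.type (ar := ar))) : (times M).type = M.type := rfl

/-! The next facts say that the type constructors are free up to isomorphism of graphs and that
they generate all types. -/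

theorem prim_inj {p q : Pr} : prim ar p = prim ar q ↔ p = q :=
  ⟨fun h => Quotient.exact h, fun h => congrArg _ h⟩

theorem div_eq_div {N N' : Tp ar} {D D' : Denom (Tp.type (ar := ar))} {h : N.type = D.type}
    {h' : N'.type = D'.type} : div N D h = div N' D' h' ↔ N = N' ∧ D.Iso D' := by
  constructor
  · intro H
    obtain ⟨hN, ν, ε, h1, h2, h3, h4⟩ := Quotient.exact H
    exact ⟨rep_equiv_rep.1 hN, ν, ε, h1, fun e => (rep_equiv_rep.1 (h2 e)).symm, h3, h4⟩
  · rintro ⟨hN, ν, ε, h1, h2, h3, h4⟩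
    exact Quotient.sound
      ⟨rep_equiv_rep.2 hN, ν, ε, h1, fun e => rep_equiv_rep.2 (h2 e).symm, h3, h4⟩

theorem times_eq_times {M M' : HGraph (Tp.type (ar := ar))} :
    times M = times M' ↔ M.Iso M' := by
  constructor
  · intro H
    obtain ⟨ν, ε, h1, h2, h3⟩ := Quotient.exact H
    exact ⟨ν, ε, h1, fun e => (rep_equiv_rep.1 (h2 e)).symm, h3⟩
  · rintro ⟨ν, ε, h1, h2, h3⟩
    exact Quotient.sound ⟨ν, ε, h1, fun e => rep_equiv_rep.2 (h2 e).symm, h3⟩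

theorem prim_ne_div {p : Pr} {N : Tp ar} {D : Denom (Tp.type (ar := ar))}
    {h : N.type = D.type} : prim ar p ≠ div N D h :=
  fun H => (show False from Quotient.exact H)

theorem prim_ne_times {p : Pr} {M : HGraph (Tp.type (ar := ar))} : prim ar p ≠ times M :=
  fun H => (show False from Quotient.exact H)

theorem div_ne_times {N : Tp ar} {D : Denom (Tp.type (ar := ar))}
    {h : N.type = D.type} {M : HGraph (Tp.type (ar := ar))} : div N D h ≠ times M :=
  fun H => (show False from Quotient.exact H)

theorem induction {motive : Tp ar → Prop} (hprim : ∀ p, motive (prim ar p))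
    (hdiv : ∀ N D h, motive N → (∀ e, motive (D.lab e)) → motive (div N D h))
    (htimes : ∀ M : HGraph (Tp.type (ar := ar)), (∀ e, motive (M.lab e)) → motive (times M))
    (t : Tp ar) : motive t := by
  suffices H : ∀ (a : PreTp Pr) (ha : a.WF ar),
      motive (Quotient.mk (PreTp.setoid ar) ⟨a, ha⟩) by
    rw [← mk_rep t]
    exact H _ _
  have key : ∀ (a : PreTp Pr) (ha : a.WF ar),
      PreTp.Equiv (rep (Quotient.mk (PreTp.setoid ar) ⟨a, ha⟩)) a :=
    fun a ha => Quotient.exact (mk_rep (Quotient.mk (PreTp.setoid ar) ⟨a, ha⟩))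
  intro a
  induction a with
  | prim p => exact fun _ => hprim p
  | div N V E att lab ext att₀ ihN ih =>
      intro ha
      obtain ⟨a1, a2, a3, a4, a5, a6, a7, a8, a9⟩ := id ha
      have := hdiv (Quotient.mk (PreTp.setoid ar) ⟨N, a1⟩)
        { V := V, E := E, finV := a2, finE := a3, att := att, att_nodup := a4,
          lab := fun e => Quotient.mk (PreTp.setoid ar) ⟨lab e, a5 e⟩, lab_type := a6,
          ext := ext, ext_nodup := a7, att₀ := att₀, att₀_nodup := a8 } a9
        (ihN a1) (fun e => ih e (a5 e))
      refine Eq.mp (congrArg motive (Quotient.sound ?_)) this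
      exact ⟨key _ _, Equiv.refl _, Equiv.refl _, fun e => by simp, fun e => key _ _,
        by simp, by simp⟩
  | times V E att lab ext ih =>
      intro ha
      obtain ⟨a2, a3, a4, a5, a6, a7⟩ := id ha
      have := htimes
        { V := V, E := E, finV := a2, finE := a3, att := att, att_nodup := a4,
          lab := fun e => Quotient.mk (PreTp.setoid ar) ⟨lab e, a5 e⟩, lab_type := a6,
          ext := ext, ext_nodup := a7 } (fun e => ih e (a5 e))
      refine Eq.mp (congrArg motive (Quotient.sound ?_)) this
      exact ⟨Equiv.refl _, Equiv.refl _, fun e => by simp, fun e => key _ _, by simp⟩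

end Tp

/-! ## The calculus `HL` -/

/-- `HLDerivable H A` means `HL ⊢ H → A`. All equations between numbers among the hypotheses only
say that the sequents and replacements in question are defined; `iso` reflects that isomorphic
graphs are not distinguished. -/
inductive HLDerivable {Pr : Type} {ar : Pr → ℕ} : HGraph (Tp.type (ar := ar)) → Tp ar → Prop where
  | ax (p : Pr) : HLDerivable (HGraph.handle Tp.type (Tp.prim ar p)) (Tp.prim ar p)
  /-- From `H → A` and `K d → lab d` for all edges `d ≠ d₀` of `D`, infer
  `H[e/D][d₀ := N ÷ D][d/K d]_d → A`, where `lab e = N`. -/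
  | divL (N : Tp ar) (D : Denom (Tp.type (ar := ar))) (hND : N.type = D.type)
      (H : HGraph (Tp.type (ar := ar))) (A : Tp ar) (e : H.E) (he : H.lab e = N)
      (K : D.E → HGraph (Tp.type (ar := ar)))
      (hK : ∀ d, (K d).type = (D.att d).length)
      (hDe : (((D.fill (Tp.div N D hND) rfl).replace Function.Embedding.some K hK).type =
        (H.att e).length)) :
      HLDerivable H A → (∀ d, HLDerivable (K d) (D.lab d)) →
      HLDerivable
        (H.replaceOne e ((D.fill (Tp.div N D hND) rfl).replace Function.Embedding.some K hK) hDe) A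
  /-- From `D[d₀/F] → N`, infer `F → N ÷ D`. The label that `d₀` carries before it is replaced
  by `F` plays no role. -/
  | divR (N : Tp ar) (D : Denom (Tp.type (ar := ar))) (hND : N.type = D.type)
      (F : HGraph (Tp.type (ar := ar))) (hF : F.type = D.att₀.length) :
      HLDerivable ((D.fill (Tp.div N D hND) rfl).replaceOne none F hF) N →
      HLDerivable F (Tp.div N D hND)
  /-- From `G[e/F] → A`, infer `G → A`, where `lab e = ×(F)`. -/
  | timesL (F G : HGraph (Tp.type (ar := ar))) (A : Tp ar) (e : G.E)
      (he : G.lab e = Tp.times F) (hF : F.type = (G.att e).length) :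
      HLDerivable (G.replaceOne e F hF) A → HLDerivable G A
  /-- From `H m → lab m` for all edges `m` of `M`, infer `M[m/H m]_m → ×(M)`. -/
  | timesR (M : HGraph (Tp.type (ar := ar))) (H : M.E → HGraph (Tp.type (ar := ar)))
      (hH : ∀ m, (H m).type = (M.att m).length) :
      (∀ m, HLDerivable (H m) (M.lab m)) → HLDerivable (M.replaceAll H hH) (Tp.times M)
  | iso (G G' : HGraph (Tp.type (ar := ar))) (A : Tp ar) :
      G.Iso G' → HLDerivable G A → HLDerivable G' A

/-! ## The translation of `L` into `HL`

The primitive types of `L` are the primitive types of `HL` of type `2`. -/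

/-- The translation `tr`, with the information that its values have type `2`. -/
noncomputable def tr₂ {Pr : Type} (ar : Pr → ℕ) :
    LTp {p : Pr // ar p = 2} → {t : Tp ar // t.type = 2}
  | .prim p => ⟨Tp.prim ar p.1, p.2⟩
  | .over A B => ⟨Tp.div (tr₂ ar A).1 (Denom.dollarLeft (tr₂ ar B)) (tr₂ ar A).2, rfl⟩
  | .under B A => ⟨Tp.div (tr₂ ar A).1 (Denom.dollarRight (tr₂ ar B)) (tr₂ ar A).2, rfl⟩
  | .mul A B => ⟨Tp.times (HGraph.str [tr₂ ar A, tr₂ ar B] (by simp)), rfl⟩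

/-- The translation `tr : Tp(L) → Tp(HL)`. -/
noncomputable def tr {Pr : Type} (ar : Pr → ℕ) (A : LTp {p : Pr // ar p = 2}) : Tp ar :=
  (tr₂ ar A).1

/-- The antecedent `tr(Γ)^•` of `tr(Γ → C)`, for nonempty `Γ`. -/
noncomputable def trAnt {Pr : Type} (ar : Pr → ℕ) (Γ : List (LTp {p : Pr // ar p = 2}))
    (hΓ : Γ ≠ []) : HGraph (Tp.type (ar := ar)) :=
  HGraph.str (Γ.map (tr₂ ar)) (by simpa using hΓ)

/-! A string graph is determined up to isomorphism by its word of labels, so the theorem reduces to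
computing words under replacement. `IsString` is the isomorphism-invariant form of this: some list
of edges runs between the two external nodes through every node and edge exactly once.
`IsString.iso` is the uniqueness.

From `L` to `HL`: replacing edges of a string graph by string graphs substitutes words for letters
(`IsStringAlong.replace`). Hence every rule of `L` is simulated by the corresponding rule of `HL`.

From `HL` to `L`: there is no cut rule, so a derivation whose final sequent has only translated
types contains only translated types. The type constructors are free up to isomorphism and `tr` is
injective, so each rule instance is the image of a rule of `L` once its graphs are known to be
string graphs. This is proved by induction on the derivation. In `(÷ →)` and `(→ ×)` the conclusion
is a replacement of edges of string graphs by string graphs. In `(→ ÷)` and `(× →)` the replacement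
sits in the premise and has to be inverted. If `F` replaces the `$`-edge of `($ b)^•` or `(b $)^•`
and the result is a string graph, then so is `F` (`IsString.of_replace_left`,
`IsString.of_replace_right`). If `(a b)^•` replaces an edge of `G` and the result is a string graph,
its two edges are consecutive there and contract back to the edge of `G`
(`IsString.of_replace_pair`).

The nonemptiness conditions of `L` come for free: the external nodes are distinct, so a string graph
has at least one edge. -/

namespace HGraph

variable {C : Type 1} {ty : C → ℕ}

/-! ### Paths and string graphs -/

/-- `G.Path x l y`: the edges in `l`, listed with their targets, lead from `x` to `y`. -/
def Path (G : HGraph ty) : G.V → List (G.E × G.V) → G.V → Prop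
  | x, [], y => x = y
  | x, (e, z) :: l, y => G.att e = [x, z] ∧ G.Path z l y

theorem path_append {G : HGraph ty} {x y : G.V} {l₁ l₂ : List (G.E × G.V)} :
    G.Path x (l₁ ++ l₂) y ↔ ∃ z, G.Path x l₁ z ∧ G.Path z l₂ y := by
  induction l₁ generalizing x with
  | nil => simp [Path]
  | cons a l ih => simp [Path, ih, and_assoc]

theorem path_map {G G' : HGraph ty} {φ : G.V → G'.V} {ψ : G.E → G'.E}
    (hφ : Function.Injective φ) (h : ∀ e, G'.att (ψ e) = (G.att e).map φ)
    {x y : G.V} {l : List (G.E × G.V)} :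
    G'.Path (φ x) (l.map (Prod.map ψ φ)) (φ y) ↔ G.Path x l y := by
  induction l generalizing x with
  | nil => simp [Path, hφ.eq_iff]
  | cons a l ih =>
    simp only [Path, List.map_cons, Prod.map, ih, h]
    rw [show [φ x, φ a.2] = [x, a.2].map φ from rfl, (List.map_injective_iff.2 hφ).eq_iff]

theorem Path.target_mem {G : HGraph ty} {x y : G.V} {l : List (G.E × G.V)} (h : G.Path x l y) :
    y ∈ x :: l.map Prod.snd := by
  induction l generalizing x with
  | nil => simp [Path] at h; simp [h]
  | cons a l ih => exact List.mem_cons_of_mem _ (ih h.2)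

/-- A nonempty closed path would visit its starting node a second time, as the target of its last
edge. -/
theorem Path.eq_nil {G : HGraph ty} {x : G.V} {l : List (G.E × G.V)} (h : G.Path x l x)
    (hl : (x :: l.map Prod.snd).Nodup) : l = [] := by
  cases l with
  | nil => rfl
  | cons a l => exact absurd (Path.target_mem h.2) (List.nodup_cons.1 hl).1

theorem Path.att_eq {G : HGraph ty} {x y z : G.V} {e : G.E} {l : List (G.E × G.V)}
    (h : G.Path x l y) (he : (e, z) ∈ l) : ∃ w, G.att e = [w, z] := by
  obtain ⟨l₁, l₂, rfl⟩ := List.append_of_mem he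
  obtain ⟨w, -, h2⟩ := path_append.1 h
  exact ⟨w, h2.1⟩

theorem Path.target_unique {G : HGraph ty} {x y z : G.V} {l : List (G.E × G.V)}
    (hy : G.Path x l y) (hz : G.Path x l z) : y = z := by
  induction l generalizing x with
  | nil => exact Eq.trans (Eq.symm hy) hz
  | cons a l ih => exact ih hy.2 hz.2

/-- One prefix extends the other by a path from `y` to `y`; as no node repeats, this extension is
empty. -/
theorem Path.prefix_unique {G : HGraph ty} {x y : G.V} {l₁ l₂ m₁ m₂ : List (G.E × G.V)}
    (hl : G.Path x l₁ y) (hm : G.Path x m₁ y) (h : l₁ ++ l₂ = m₁ ++ m₂)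
    (hn : (x :: (l₁ ++ l₂).map Prod.snd).Nodup) : l₁ = m₁ ∧ l₂ = m₂ := by
  have key : ∀ {a b c d : List (G.E × G.V)}, G.Path x a y → G.Path x b y → b = a ++ c →
      (x :: (b ++ d).map Prod.snd).Nodup → c = [] := by
    rintro a b c d ha hb rfl hn
    obtain ⟨z, h1, h2⟩ := path_append.1 hb
    have : z = y := by
      clear hb h2 hn
      exact h1.target_unique ha
    subst this
    refine h2.eq_nil (List.nodup_cons.2 ⟨fun hz => ?_, ?_⟩)
    · have := ha.target_mem
      simp only [List.append_assoc, List.map_append] at hn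
      rw [← List.cons_append] at hn
      exact (List.disjoint_of_nodup_append hn) this (List.mem_append_left _ hz)
    · simp only [List.append_assoc, List.map_append, List.nodup_cons, List.nodup_append] at hn
      exact hn.2.2.1.1
  rcases List.append_eq_append_iff.1 h with ⟨c, h1, h2⟩ | ⟨c, h1, h2⟩
  · have := key hl hm h1 (h ▸ hn)
    simp_all
  · have := key hm hl h1 hn
    simp_all

/-- The list `l` of edges with their targets traverses the whole graph `G` from `s` to `t`,
visiting every node and every edge exactly once, and `s`, `t` are the external nodes. -/
structure IsStringAlong (G : HGraph ty) (s : G.V) (l : List (G.E × G.V)) (t : G.V) : Prop where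
  path : G.Path s l t
  nodup : (s :: l.map Prod.snd).Nodup
  mem_node : ∀ v, v ∈ s :: l.map Prod.snd
  mem_edge : ∀ e, e ∈ l.map Prod.fst
  ext_eq : G.ext = [s, t]

/-- The string of labels along a list of edges. -/
def word (G : HGraph ty) (l : List (G.E × G.V)) : List C := l.map fun a => G.lab a.1

/-- `G` is a string graph with label string `w`. -/
def IsString (G : HGraph ty) (w : List C) : Prop :=
  ∃ s l t, G.IsStringAlong s l t ∧ G.word l = w

namespace IsStringAlong

variable {G : HGraph ty} {s t : G.V} {l : List (G.E × G.V)}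

theorem source_ne_target (h : G.IsStringAlong s l t) : s ≠ t := by
  have := G.ext_nodup
  rw [h.ext_eq] at this
  simpa using this

theorem target_mem (h : G.IsStringAlong s l t) : t ∈ l.map Prod.snd :=
  (List.mem_cons.1 h.path.target_mem).resolve_left h.source_ne_target.symm

theorem target_eq (h : G.IsStringAlong s l t) {e : G.E} {y z : G.V} (h1 : (e, y) ∈ l)
    (h2 : (e, z) ∈ l) : y = z := by
  obtain ⟨w, hw⟩ := h.path.att_eq h1
  obtain ⟨w', hw'⟩ := h.path.att_eq h2
  rw [hw] at hw'
  simp_all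

theorem edge_eq (h : G.IsStringAlong s l t) {e e' : G.E} {y : G.V} (h1 : (e, y) ∈ l)
    (h2 : (e', y) ∈ l) : e = e' :=
  congrArg Prod.fst (List.inj_on_of_nodup_map (List.nodup_cons.1 h.nodup).2 h1 h2 rfl)

/-- Only nodes are required not to repeat. An edge determines its target through `att`, so a
repeated edge would repeat a node. -/
theorem edge_nodup (h : G.IsStringAlong s l t) : (l.map Prod.fst).Nodup := by
  refine List.Nodup.map_on ?_ (List.Nodup.of_map _ (List.nodup_cons.1 h.nodup).2)
  rintro ⟨e, y⟩ h1 ⟨e', y'⟩ h2 (rfl : e = e')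
  rw [h.target_eq h1 h2]

theorem type_eq (h : G.IsStringAlong s l t) : G.type = 2 := by simp [type, h.ext_eq]

theorem att_length (h : G.IsStringAlong s l t) (e : G.E) : (G.att e).length = 2 := by
  obtain ⟨⟨e', y⟩, h1, rfl⟩ := List.mem_map.1 (h.mem_edge e)
  obtain ⟨w, hw⟩ := h.path.att_eq h1
  simp [hw]

theorem split_edge (h : G.IsStringAlong s l t) {e : G.E} {x y : G.V} (he : G.att e = [x, y]) :
    ∃ l₁ l₂, l = l₁ ++ (e, y) :: l₂ ∧ G.Path s l₁ x ∧ G.Path y l₂ t := by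
  obtain ⟨⟨e', y'⟩, h1, rfl⟩ := List.mem_map.1 (h.mem_edge e)
  obtain ⟨l₁, l₂, rfl⟩ := List.append_of_mem h1
  obtain ⟨z, h2, h3⟩ := path_append.1 h.path
  have := h3.1
  simp only [he, List.cons.injEq, and_true] at this
  obtain ⟨rfl, rfl⟩ := this
  exact ⟨l₁, l₂, rfl, h2, h3.2⟩

theorem exists_split (h : G.IsStringAlong s l t) (e : G.E) :
    ∃ l₁ y l₂, l = l₁ ++ (e, y) :: l₂ := by
  obtain ⟨⟨e', y⟩, h1, rfl⟩ := List.mem_map.1 (h.mem_edge e)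
  obtain ⟨l₁, l₂, rfl⟩ := List.append_of_mem h1
  exact ⟨l₁, y, l₂, rfl⟩

/-- The shared node `y` occurs only once in the traversal, so the edge leaving it comes directly
after the edge entering it. -/
theorem split_two_edges (h : G.IsStringAlong s l t) {e f : G.E} {x y z : G.V}
    (he : G.att e = [x, y]) (hf : G.att f = [y, z]) :
    ∃ l₁ l₂, l = l₁ ++ (e, y) :: (f, z) :: l₂ ∧ G.Path s l₁ x ∧ G.Path z l₂ t := by
  obtain ⟨l₁, l₂, h1, h2, h3⟩ := h.split_edge he
  obtain ⟨m₁, m₂, k1, k2, k3⟩ := h.split_edge hf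
  have hp : G.Path s (l₁ ++ [(e, y)]) y := path_append.2 ⟨x, h2, he, rfl⟩
  have hs : (l₁ ++ [(e, y)]) ++ l₂ = m₁ ++ (f, z) :: m₂ := by simp [← h1, ← k1]
  obtain ⟨-, rfl⟩ := hp.prefix_unique k2 hs (by simpa [h1] using h.nodup)
  exact ⟨l₁, m₂, h1, h2, k3⟩

/-- Transport along an isomorphism. -/
theorem map {G' : HGraph ty} (h : G.IsStringAlong s l t) (ν : G.V ≃ G'.V) (ε : G.E ≃ G'.E)
    (hatt : ∀ e, G'.att (ε e) = (G.att e).map ν) (hext : G'.ext = G.ext.map ν) :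
    G'.IsStringAlong (ν s) (l.map (Prod.map ε ν)) (ν t) where
  path := (path_map ν.injective hatt).2 h.path
  nodup := by
    have := h.nodup.map ν.injective
    simpa [Function.comp_def] using this
  mem_node v := by
    have := List.mem_map_of_mem (f := ν) (h.mem_node (ν.symm v))
    simpa [Function.comp_def] using this
  mem_edge e := by
    have := List.mem_map_of_mem (f := ε) (h.mem_edge (ε.symm e))
    simpa [Function.comp_def] using this
  ext_eq := by simp [hext, h.ext_eq]

/-- The positional form of a path, used to match two traversals index by index in `IsString.iso`. -/
theorem att_getElem (h : G.IsStringAlong s l t) (i : ℕ) (hi : i < l.length) :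
    G.att l[i].1 = [(s :: l.map Prod.snd)[i]'(by simp; omega),
      (s :: l.map Prod.snd)[i + 1]'(by simpa using hi)] := by
  have key : ∀ (l : List (G.E × G.V)) (s : G.V), G.Path s l t → ∀ i (hi : i < l.length),
      G.att l[i].1 = [(s :: l.map Prod.snd)[i]'(by simp; omega),
      (s :: l.map Prod.snd)[i + 1]'(by simpa using hi)] := by
    intro l
    induction l with
    | nil => intro s _ i hi; simp at hi
    | cons a l ih =>
      intro s hp i hi
      cases i with
      | zero => simpa using hp.1
      | succ i => simpa using ih a.2 hp.2 i (by simpa using hi)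
  exact key l s h.path i hi

theorem getLast_eq (h : G.IsStringAlong s l t) :
    (s :: l.map Prod.snd)[l.length]'(by simp) = t := by
  have key : ∀ (l : List (G.E × G.V)) (s : G.V), G.Path s l t →
      (s :: l.map Prod.snd)[l.length]'(by simp) = t := by
    intro l
    induction l with
    | nil => intro s hp; exact hp
    | cons a l ih => intro s hp; simpa using ih a.2 hp.2
  exact key l s h.path

end IsStringAlong

theorem path_of_getElem {G : HGraph ty} (l : List (G.E × G.V)) (s : G.V)
    (h : ∀ i (hi : i < l.length), G.att l[i].1 = [(s :: l.map Prod.snd)[i]'(by simp; omega),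
      (s :: l.map Prod.snd)[i + 1]'(by simpa using hi)]) :
    G.Path s l ((s :: l.map Prod.snd)[l.length]'(by simp)) := by
  induction l generalizing s with
  | nil => rfl
  | cons a l ih =>
    exact ⟨h 0 (by simp), ih a.2 fun i hi => h (i + 1) (by simpa using hi)⟩

theorem IsString.of_iso {G G' : HGraph ty} {w : List C} (h : G.IsString w) (hi : G.Iso G') :
    G'.IsString w := by
  obtain ⟨s, l, t, h, rfl⟩ := h
  obtain ⟨ν, ε, h1, h2, h3⟩ := hi
  exact ⟨_, _, _, h.map ν ε h1 h3, by simp [word, h2]⟩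

theorem IsString.ne_nil {G : HGraph ty} {w : List C} (h : G.IsString w) : w ≠ [] := by
  obtain ⟨s, l, t, h, rfl⟩ := h
  have := h.target_mem
  rintro h0
  simp only [word, List.map_eq_nil_iff] at h0
  simp [h0] at this

theorem IsString.type_eq {G : HGraph ty} {w : List C} (h : G.IsString w) : G.type = 2 := by
  obtain ⟨s, l, t, h, rfl⟩ := h
  exact h.type_eq

/-- Surjectivity of `ed` is enough: edges are separated by their targets, and `nd` is injective. -/
theorem isString_of_fin (G : HGraph ty) {n : ℕ} (nd : Fin (n + 1) → G.V) (ed : Fin n → G.E)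
    (hnd : Function.Bijective nd) (hed : Function.Surjective ed)
    (hatt : ∀ i, G.att (ed i) = [nd i.castSucc, nd i.succ])
    (hext : G.ext = [nd 0, nd (Fin.last n)]) : G.IsString (List.ofFn fun i => G.lab (ed i)) := by
  let l : List (G.E × G.V) := List.ofFn fun i => (ed i, nd i.succ)
  have hl : nd 0 :: l.map Prod.snd = List.ofFn nd := by
    simp [l, List.ofFn_succ, List.map_ofFn, Function.comp_def]
  have hlen : l.length = n := by simp [l]
  have hget : ∀ i (hi : i < n + 1),
      (nd 0 :: l.map Prod.snd)[i]'(by simpa [hlen] using hi) = nd ⟨i, hi⟩ := by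
    intro i hi
    rw [List.getElem_of_eq hl, List.getElem_ofFn]
  have hpath := path_of_getElem l (nd 0) (by
    intro i hi
    rw [hget i (by omega), hget (i + 1) (by omega)]
    simp only [l, List.getElem_ofFn]
    exact hatt ⟨i, by omega⟩)
  refine ⟨_, l, _, ⟨hpath, ?_, ?_, ?_, ?_⟩, ?_⟩
  · rw [hl]; exact List.nodup_ofFn.2 hnd.1
  · rw [hl]; exact fun v => List.mem_ofFn.2 (hnd.2 v)
  · intro e
    obtain ⟨i, rfl⟩ := hed e
    simp [l, List.map_ofFn, List.mem_ofFn, Function.comp_def]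
  · rw [hget l.length (by omega)]
    simp [hext, hlen, Fin.last]
  · simp [word, l, List.map_ofFn, Function.comp_def]

theorem isString_str (w : List {c : C // ty c = 2}) (hw : w ≠ []) :
    (str w hw).IsString (w.map Subtype.val) := by
  have := isString_of_fin (str w hw) (n := w.length) id id Function.bijective_id
    Function.surjective_id (fun _ => rfl) rfl
  convert this using 1
  apply List.ext_getElem <;> simp [str]

/-- String graphs with the same label string are isomorphic. -/
theorem IsString.iso {G G' : HGraph ty} {w : List C} (h : G.IsString w) (h' : G'.IsString w) :
    G.Iso G' := by
  classical
  obtain ⟨s, l, t, h, rfl⟩ := h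
  obtain ⟨s', l', t', h', hw⟩ := h'
  have hlen : l'.length = l.length := by simpa [word] using congrArg List.length hw
  -- Each traversal enumerates nodes and edges without repetition; the isomorphism sends the `i`-th
  -- item of one to the `i`-th item of the other.
  let a := h.nodup.getEquivOfForallMemList _ h.mem_node
  let a' := h'.nodup.getEquivOfForallMemList _ h'.mem_node
  let b := h.edge_nodup.getEquivOfForallMemList _ h.mem_edge
  let b' := h'.edge_nodup.getEquivOfForallMemList _ h'.mem_edge
  let ν : G.V ≃ G'.V := a.symm.trans ((finCongr (by simp [hlen])).trans a')
  let ε : G.E ≃ G'.E := b.symm.trans ((finCongr (by simp [hlen])).trans b')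
  have hν : ∀ i (hi : i < (s :: l.map Prod.snd).length), ν (s :: l.map Prod.snd)[i] =
      (s' :: l'.map Prod.snd)[i]'(by simpa [hlen] using hi) := by
    intro i hi
    have : (s :: l.map Prod.snd)[i] = a ⟨i, hi⟩ := rfl
    rw [this]
    simp only [ν, Equiv.trans_apply, Equiv.symm_apply_apply]
    rfl
  have hε : ∀ i (hi : i < l.length), ε l[i].1 = (l'[i]'(hlen ▸ hi)).1 := by
    intro i hi
    have : l[i].1 = b ⟨i, by simpa using hi⟩ := by
      simp [b]
    rw [this]
    simp only [ε, Equiv.trans_apply, Equiv.symm_apply_apply]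
    simp [b']
  have hex : ∀ e, ∃ i, ∃ hi : i < l.length, l[i].1 = e := by
    intro e
    obtain ⟨i, hi, h1⟩ := List.getElem_of_mem (h.mem_edge e)
    exact ⟨i, by simpa using hi, by simpa using h1⟩
  refine ⟨ν, ε, fun e => ?_, fun e => ?_, ?_⟩
  · obtain ⟨i, hi, rfl⟩ := hex e
    rw [hε i hi, h'.att_getElem, h.att_getElem i hi, List.map_cons, List.map_cons, hν, hν]
    rfl
  · obtain ⟨i, hi, rfl⟩ := hex e
    rw [hε i hi]
    have := List.getElem_of_eq hw (i := i) (by simpa [word, hlen] using hi)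
    simpa [word] using this
  · rw [h'.ext_eq, h.ext_eq]
    have h0 := hν 0 (by simp)
    have h1 := hν l.length (by simp)
    rw [h.getLast_eq] at h1
    have h2 := h'.getLast_eq
    simp only [hlen] at h2
    simp only [List.getElem_cons_zero] at h0
    simp [h0, h1, h2]

theorem isString_handle {a : C} (ha : ty a = 2) : (handle ty a).IsString [a] := by
  -- Naming the two elements of `finRange (ty a)` avoids rewriting along `ty a = 2` inside the node
  -- type.
  obtain ⟨x, y, hxy⟩ := List.length_eq_two.1 ((List.length_finRange (n := ty a)).trans ha)
  have hn := List.nodup_finRange (ty a)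
  have hm := List.mem_finRange (n := ty a)
  rw [hxy] at hn hm
  exact ⟨x, [((), y)], y, ⟨⟨hxy, rfl⟩, hn, hm, fun e => List.mem_singleton.2 rfl, hxy⟩,
    rfl⟩

/-! ### Replacement in string graphs -/

section

variable (G : HGraph ty) {ι : Type} (f : ι ↪ G.E) (K : ι → HGraph ty)
  (h : ∀ i, (K i).type = (G.att (f i)).length)

/-- A node of `G` as a node of `G[f i / K i]`. -/
def oldNode (v : G.V) : (G.replace f K h).V := Sum.inl v

/-- The image of a node of `K i` in `G[f i / K i]`. -/
noncomputable def newNode (i : ι) (v : (K i).V) : (G.replace f K h).V := replaceNode G f K h i v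

/-- An edge of `G` that is not replaced, as an edge of `G[f i / K i]`. -/
def oldEdge (e : G.E) (he : e ∉ Set.range f) : (G.replace f K h).E := Sum.inl ⟨e, he⟩

/-- An edge of `K i` as an edge of `G[f i / K i]`. -/
def newEdge (i : ι) (e : (K i).E) : (G.replace f K h).E := Sum.inr ⟨i, e⟩

theorem oldNode_injective : Function.Injective (oldNode G f K h) := Sum.inl_injective

theorem newNode_injective (i : ι) : Function.Injective (newNode G f K h i) :=
  replaceNode_injective G f K h i

theorem newEdge_injective (i : ι) : Function.Injective (newEdge G f K h i) :=
  Sum.inr_injective.comp sigma_mk_injective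

theorem oldEdge_inj {e e' : G.E} {he : e ∉ Set.range f} {he' : e' ∉ Set.range f} :
    oldEdge G f K h e he = oldEdge G f K h e' he' ↔ e = e' :=
  ⟨fun H => congrArg Subtype.val (Sum.inl.inj H), by rintro rfl; rfl⟩

theorem oldEdge_ne_newEdge {e : G.E} {he : e ∉ Set.range f} {i : ι} {g : (K i).E} :
    oldEdge G f K h e he ≠ newEdge G f K h i g := Sum.inl_ne_inr

theorem edge_cases (x : (G.replace f K h).E) :
    (∃ e he, x = oldEdge G f K h e he) ∨ ∃ i g, x = newEdge G f K h i g := by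
  rcases x with ⟨e, he⟩ | ⟨i, g⟩
  · exact Or.inl ⟨e, he, rfl⟩
  · exact Or.inr ⟨i, g, rfl⟩

theorem newNode_of_notMem {i : ι} {v : (K i).V} (hv : v ∉ (K i).ext) :
    newNode G f K h i v = Sum.inr ⟨i, v, hv⟩ := by
  rw [newNode, replaceNode, dif_neg hv]

theorem node_cases (x : (G.replace f K h).V) :
    (∃ v, x = oldNode G f K h v) ∨ ∃ i v, v ∉ (K i).ext ∧ x = newNode G f K h i v := by
  rcases x with v | ⟨i, v, hv⟩
  · exact Or.inl ⟨v, rfl⟩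
  · exact Or.inr ⟨i, v, hv, (newNode_of_notMem G f K h hv).symm⟩

theorem newNode_ne_oldNode {i : ι} {v : (K i).V} (hv : v ∉ (K i).ext) (p : G.V) :
    newNode G f K h i v ≠ oldNode G f K h p := by
  rw [newNode_of_notMem G f K h hv]
  exact Sum.inr_ne_inl

theorem newNode_index_eq {i j : ι} {v : (K i).V} {w : (K j).V} (hv : v ∉ (K i).ext)
    (hw : w ∉ (K j).ext) (H : newNode G f K h i v = newNode G f K h j w) : i = j := by
  rw [newNode_of_notMem G f K h hv, newNode_of_notMem G f K h hw] at H
  exact congrArg Sigma.fst (Sum.inr.inj H)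

/-- The fusion of external nodes, unfolded for type `2`. Later arguments use it instead of the index
computation in `replaceNode`. -/
theorem newNode_of_ext {i : ι} {x y : (K i).V} {p q : G.V} (hK : (K i).ext = [x, y])
    (hG : G.att (f i) = [p, q]) :
    newNode G f K h i x = oldNode G f K h p ∧ newNode G f K h i y = oldNode G f K h q := by
  classical
  have hxy : x ≠ y := by
    have := (K i).ext_nodup
    rw [hK] at this
    simpa using this
  constructor
  · rw [newNode, oldNode, replaceNode, dif_pos (by simp [hK])]
    simp [hK, hG]
    rfl
  · rw [newNode, oldNode, replaceNode, dif_pos (by simp [hK])]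
    simp [hK, hG, hxy]
    rfl

theorem replace_att_oldEdge (e : G.E) (he : e ∉ Set.range f) :
    (G.replace f K h).att (oldEdge G f K h e he) = (G.att e).map (oldNode G f K h) := rfl

theorem replace_att_newEdge (i : ι) (e : (K i).E) :
    (G.replace f K h).att (newEdge G f K h i e) = ((K i).att e).map (newNode G f K h i) := rfl

theorem replace_lab_oldEdge (e : G.E) (he : e ∉ Set.range f) :
    (G.replace f K h).lab (oldEdge G f K h e he) = G.lab e := rfl

theorem replace_lab_newEdge (i : ι) (e : (K i).E) :
    (G.replace f K h).lab (newEdge G f K h i e) = (K i).lab e := rfl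

theorem replace_ext : (G.replace f K h).ext = G.ext.map (oldNode G f K h) := rfl

end

section

variable {G : HGraph ty} {ι : Type} {f : ι ↪ G.E} {K : ι → HGraph ty}
  {h : ∀ i, (K i).type = (G.att (f i)).length}

/-- Replacing edges of a string graph by string graphs yields a string graph. -/
theorem IsStringAlong.replace {s t : G.V} {l : List (G.E × G.V)} (hG : G.IsStringAlong s l t)
    (W : G.E → List C) (hW : ∀ i, (K i).IsString (W (f i)))
    (hW' : ∀ e, e ∉ Set.range f → W e = [G.lab e]) :
    (G.replace f K h).IsString (l.flatMap fun a => W a.1) := by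
  classical
  choose a m b hK hw using hW
  -- `B` turns one entry of the old traversal into a block of the new one: the image of the
  -- traversal of `K i` for a replaced edge, a single entry otherwise. The new traversal is the
  -- concatenation of the blocks.
  obtain ⟨B, hB1, hB2⟩ : ∃ B : G.E × G.V → List ((G.replace f K h).E × (G.replace f K h).V),
      (∀ i y, B (f i, y) = (m i).map (Prod.map (newEdge G f K h i) (newNode G f K h i))) ∧
      ∀ e y (he : e ∉ Set.range f), B (e, y) = [(oldEdge G f K h e he, oldNode G f K h y)] := by
    refine ⟨fun q => if hq : ∃ i, f i = q.1 then (m hq.choose).map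
        (Prod.map (newEdge G f K h hq.choose) (newNode G f K h hq.choose))
      else [(oldEdge G f K h q.1 hq, oldNode G f K h q.2)], fun i y => ?_, fun e y he => ?_⟩
    · have hq : ∃ j, f j = (f i, y).1 := ⟨i, rfl⟩
      have hc : hq.choose = i := f.injective hq.choose_spec
      refine (dif_pos hq).trans ?_
      rw [hc]
    · exact dif_neg (c := ∃ i, f i = (e, y).1) he
  have hBpath : ∀ e x y, G.att e = [x, y] →
      (G.replace f K h).Path (oldNode G f K h x) (B (e, y)) (oldNode G f K h y) := by
    intro e x y he
    by_cases hr : e ∈ Set.range f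
    · obtain ⟨i, rfl⟩ := hr
      obtain ⟨h1, h2⟩ := newNode_of_ext G f K h (hK i).ext_eq he
      rw [hB1, ← h1, ← h2]
      exact (path_map (newNode_injective G f K h i) (fun _ => rfl)).2 (hK i).path
    · rw [hB2 e y hr]
      exact ⟨by rw [replace_att_oldEdge, he]; rfl, rfl⟩
  -- The source of `K i` is never a target in its own traversal, so the only old node among the
  -- targets of a block is the target of its entry.
  have hBtarget : ∀ e y, (e, y) ∈ l → ∀ v, v ∈ (B (e, y)).map Prod.snd →
      v = oldNode G f K h y ∨ ∃ i w, f i = e ∧ w ∉ (K i).ext ∧ v = newNode G f K h i w := by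
    intro e y he v hv
    by_cases hr : e ∈ Set.range f
    · obtain ⟨i, rfl⟩ := hr
      obtain ⟨x, hx⟩ := hG.path.att_eq he
      rw [hB1, List.map_map] at hv
      obtain ⟨⟨g, w⟩, hg, rfl⟩ := List.mem_map.1 hv
      by_cases hw : w ∈ (K i).ext
      · have hn := (List.nodup_cons.1 (hK i).nodup).1
        rw [(hK i).ext_eq] at hw
        rcases List.mem_cons.1 hw with rfl | hw
        · exact absurd (List.mem_map_of_mem (f := Prod.snd) hg) hn
        · obtain rfl := List.mem_singleton.1 hw
          exact Or.inl (newNode_of_ext G f K h (hK i).ext_eq hx).2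
      · exact Or.inr ⟨i, w, rfl, hw, rfl⟩
    · rw [hB2 e y hr] at hv
      exact Or.inl (by simpa using hv)
  have hBold : ∀ e y, (e, y) ∈ l → oldNode G f K h y ∈ (B (e, y)).map Prod.snd := by
    intro e y he
    by_cases hr : e ∈ Set.range f
    · obtain ⟨i, rfl⟩ := hr
      obtain ⟨x, hx⟩ := hG.path.att_eq he
      obtain ⟨q, hq, hv⟩ := List.mem_map.1 (hK i).target_mem
      rw [hB1, List.map_map]
      refine List.mem_map.2 ⟨q, hq, ?_⟩
      rw [← (newNode_of_ext G f K h (hK i).ext_eq hx).2, ← hv]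
      rfl
    · simp [hB2 e y hr]
  refine ⟨oldNode G f K h s, l.flatMap B, oldNode G f K h t, ⟨?_, ?_, ?_, ?_, ?_⟩, ?_⟩
  · have key : ∀ (l : List (G.E × G.V)) (s : G.V), G.Path s l t →
        (G.replace f K h).Path (oldNode G f K h s) (l.flatMap B) (oldNode G f K h t) := by
      intro l
      induction l with
      | nil => intro s hp; exact congrArg _ hp
      | cons q l ih =>
        intro s hp
        rw [List.flatMap_cons]
        exact path_append.2 ⟨_, hBpath q.1 s q.2 hp.1, ih q.2 hp.2⟩
    exact key l s hG.path
  · rw [List.map_flatMap, List.nodup_cons, List.nodup_flatMap]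
    refine ⟨fun hs => ?_, fun q hq => ?_, ?_⟩
    · obtain ⟨⟨e, y⟩, he, hs⟩ := List.mem_flatMap.1 hs
      rcases hBtarget e y he _ hs with h1 | ⟨i, v', -, h1, h2⟩
      · obtain rfl := oldNode_injective G f K h h1
        exact (List.nodup_cons.1 hG.nodup).1 (List.mem_map_of_mem (f := Prod.snd) he)
      · exact newNode_ne_oldNode G f K h h1 _ h2.symm
    · obtain ⟨e, y⟩ := q
      by_cases hr : e ∈ Set.range f
      · obtain ⟨i, rfl⟩ := hr
        rw [hB1, List.map_map]
        have := (List.nodup_cons.1 (hK i).nodup).2.map (newNode_injective G f K h i)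
        simpa [Function.comp_def] using this
      · simp [hB2 e y hr]
    -- Blocks of different entries are disjoint: an old target identifies its entry, and an internal
    -- node of `K i` identifies `i`.
    · refine (List.Nodup.of_map _ hG.edge_nodup).pairwise_of_forall_ne ?_
      rintro ⟨e, y⟩ he ⟨e', y'⟩ he' hne v hv hv'
      rcases hBtarget e y he v hv with rfl | ⟨i, v₁, hi, h1, rfl⟩
      · rcases hBtarget e' y' he' _ hv' with h2 | ⟨i, v₁, -, h2, h3⟩
        · obtain rfl := oldNode_injective G f K h h2
          exact hne (by rw [hG.edge_eq he he'])
        · exact newNode_ne_oldNode G f K h h2 _ h3.symm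
      · rcases hBtarget e' y' he' _ hv' with h2 | ⟨j, v₂, hj, h2, h3⟩
        · exact newNode_ne_oldNode G f K h h1 _ h2
        · obtain rfl := newNode_index_eq G f K h h1 h2 h3
          subst hi
          subst hj
          exact hne (by rw [hG.target_eq he he'])
  · rw [List.map_flatMap]
    intro x
    rcases node_cases G f K h x with ⟨v, rfl⟩ | ⟨i, v, hv, rfl⟩
    · rcases List.mem_cons.1 (hG.mem_node v) with rfl | hv
      · exact List.mem_cons_self
      · obtain ⟨⟨e, y⟩, he, rfl⟩ := List.mem_map.1 hv
        exact List.mem_cons_of_mem _ (List.mem_flatMap.2 ⟨_, he, hBold e y he⟩)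
    · obtain ⟨⟨e, y⟩, he, h1⟩ := List.mem_map.1 (hG.mem_edge (f i))
      obtain rfl : e = f i := h1
      refine List.mem_cons_of_mem _ (List.mem_flatMap.2 ⟨_, he, ?_⟩)
      rw [hB1, List.map_map]
      have hv' := (List.mem_cons.1 ((hK i).mem_node v)).resolve_left
        fun h0 => hv (by simp [h0, (hK i).ext_eq])
      obtain ⟨q, hq, rfl⟩ := List.mem_map.1 hv'
      exact List.mem_map.2 ⟨q, hq, rfl⟩
  · rw [List.map_flatMap]
    intro x
    rcases edge_cases G f K h x with ⟨e, hr, rfl⟩ | ⟨i, g, rfl⟩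
    · obtain ⟨⟨e', y⟩, he, h1⟩ := List.mem_map.1 (hG.mem_edge e)
      obtain rfl : e' = e := h1
      exact List.mem_flatMap.2 ⟨_, he, by simp [hB2 e' y hr]⟩
    · obtain ⟨⟨e, y⟩, he, h1⟩ := List.mem_map.1 (hG.mem_edge (f i))
      obtain rfl : e = f i := h1
      refine List.mem_flatMap.2 ⟨_, he, ?_⟩
      rw [hB1, List.map_map]
      obtain ⟨q, hq, rfl⟩ := List.mem_map.1 ((hK i).mem_edge g)
      exact List.mem_map.2 ⟨q, hq, rfl⟩
  · simp [replace_ext, hG.ext_eq]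
  · rw [word, List.map_flatMap]
    refine List.flatMap_congr ?_
    rintro ⟨e, y⟩ he
    by_cases hr : e ∈ Set.range f
    · obtain ⟨i, rfl⟩ := hr
      rw [hB1, ← hw i]
      simp [word, replace_lab_newEdge]
    · rw [hB2 e y hr, hW' e hr]
      simp [replace_lab_oldEdge]

end

section ReplaceOne

variable {G F : HGraph ty} {e : G.E} {h : F.type = (G.att e).length}

theorem IsStringAlong.replaceOne {s y t : G.V} {l₁ l₂ : List (G.E × G.V)} {u : List C}
    (hG : G.IsStringAlong s (l₁ ++ (e, y) :: l₂) t) (hF : F.IsString u) :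
    (G.replaceOne e F h).IsString (G.word l₁ ++ u ++ G.word l₂) := by
  classical
  have := IsStringAlong.replace (f := ⟨fun _ : Unit => e, fun _ _ _ => rfl⟩) (K := fun _ => F)
    (h := fun _ => h) hG (fun g => if g = e then u else [G.lab g])
    (fun i => (if_pos (c := e = e) rfl).symm ▸ hF)
    (fun g hg => by
      have : g ≠ e := fun h0 => hg ⟨(), h0.symm⟩
      simp [this])
  have hn := hG.edge_nodup
  -- Away from `e` the substitution is trivial, and `e` occurs only once in the traversal.
  have key : ∀ l : List (G.E × G.V), e ∉ l.map Prod.fst →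
      (l.flatMap fun a => if a.1 = e then u else [G.lab a.1]) = G.word l := by
    intro l hl
    induction l with
    | nil => rfl
    | cons a l ih =>
      simp only [List.map_cons, List.mem_cons, not_or] at hl
      simp only [List.flatMap_cons, ih hl.2, if_neg (Ne.symm hl.1), word, List.map_cons]
      rfl
  rw [List.map_append, List.map_cons, List.nodup_append, List.nodup_cons] at hn
  rw [List.flatMap_append, List.flatMap_cons, key l₂ hn.2.1.1,
    key l₁ fun h0 => hn.2.2 _ h0 _ List.mem_cons_self rfl] at this
  simpa [HGraph.replaceOne] using this

end ReplaceOne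

/-! ### Recovering string graphs from the result of a replacement. -/

section Converse

variable {G F : HGraph ty} {f : Unit ↪ G.E} {h : ∀ i, F.type = (G.att (f i)).length}

theorem exists_ext_of_replace {s t : (G.replace f (fun _ => F) h).V}
    {l : List ((G.replace f (fun _ => F) h).E × (G.replace f (fun _ => F) h).V)}
    (hR : (G.replace f (fun _ => F) h).IsStringAlong s l t) :
    ∃ s' t', G.ext = [s', t'] ∧ s = oldNode G f (fun _ => F) h s' ∧
      t = oldNode G f (fun _ => F) h t' := by
  have h1 := hR.ext_eq
  rw [replace_ext] at h1
  have h2 := congrArg List.length h1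
  rw [List.length_map] at h2
  obtain ⟨s', t', h3⟩ := List.length_eq_two.1 h2
  simp only [h3, List.map_cons, List.map_nil, List.cons.injEq, and_true] at h1
  exact ⟨s', t', h3, h1.1.symm, h1.2.symm⟩

/-- A stretch from `p` to `q` that uses only new edges, with only old edges outside it, pulls back
to a traversal of `F`. It covers `F`: a new edge can only lie in the stretch, and an internal node
of `F` is attached to no old edge. -/
theorem IsStringAlong.inner_of_replace {p q : G.V} (he : G.att (f ()) = [p, q])
    {l₁ l l₂ : List ((G.replace f (fun _ => F) h).E × (G.replace f (fun _ => F) h).V)}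
    {s t : (G.replace f (fun _ => F) h).V}
    (hR : (G.replace f (fun _ => F) h).IsStringAlong s (l₁ ++ l ++ l₂) t)
    (hs : (G.replace f (fun _ => F) h).Path s l₁ (oldNode G f _ h p))
    (hp : (G.replace f (fun _ => F) h).Path (oldNode G f _ h p) l (oldNode G f _ h q))
    (h1 : ∀ a ∈ l₁ ++ l₂, ∃ g hg, a.1 = oldEdge G f _ h g hg)
    (h2 : ∀ a ∈ l, ∃ g, a.1 = newEdge G f _ h () g) :
    F.IsString ((G.replace f (fun _ => F) h).word l) := by
  obtain ⟨x, y, hF⟩ := List.length_eq_two.1 ((h ()).trans (by simp [he]) : F.ext.length = 2)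
  have hxy : x ≠ y := by
    have := F.ext_nodup
    rw [hF] at this
    simpa using this
  obtain ⟨hx, hy⟩ := newNode_of_ext G f (fun _ => F) h (i := ()) hF he
  have hl : ∀ a ∈ l, a ∈ Set.range
      (Prod.map (newEdge G f (fun _ => F) h ()) (newNode G f (fun _ => F) h ())) := by
    rintro ⟨e, z⟩ ha
    obtain ⟨g, hg⟩ := h2 _ ha
    obtain rfl : e = newEdge G f (fun _ => F) h () g := hg
    obtain ⟨w, hw⟩ := hp.att_eq ha
    have hz : z ∈ (F.att g).map (newNode G f (fun _ => F) h ()) := by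
      rw [← replace_att_newEdge G f (fun _ => F) h, hw]
      simp
    obtain ⟨v, -, rfl⟩ := List.mem_map.1 hz
    exact ⟨(g, v), rfl⟩
  obtain ⟨m, rfl⟩ : ∃ m, List.map (Prod.map (newEdge G f (fun _ => F) h ())
      (newNode G f (fun _ => F) h ())) m = l := by
    have : l ∈ Set.range (List.map (Prod.map (newEdge G f (fun _ => F) h ())
      (newNode G f (fun _ => F) h ()))) := by
      rw [Set.range_list_map]
      exact hl
    exact this
  rw [← hx, ← hy] at hp
  have hpath := (path_map (newNode_injective G f (fun _ => F) h ()) (fun _ => rfl)).1 hp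
  have hym : y ∈ m.map Prod.snd :=
    (List.mem_cons.1 hpath.target_mem).resolve_left hxy.symm
  obtain ⟨s', t', -, rfl, rfl⟩ := exists_ext_of_replace hR
  refine ⟨x, m, y, ⟨hpath, ?_, ?_, ?_, hF⟩, ?_⟩
  · refine List.Nodup.of_map (newNode G f (fun _ => F) h ()) ?_
    have hn := hR.nodup
    rw [List.append_assoc, List.map_append, ← List.cons_append, List.map_append,
      List.nodup_append, List.nodup_append, List.map_map] at hn
    have hm : List.map (newNode G f (fun _ => F) h ()) (m.map Prod.snd) =
        List.map (Prod.snd ∘ Prod.map (newEdge G f (fun _ => F) h ())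
          (newNode G f (fun _ => F) h ())) m := by
      simp
    -- The start of the stretch is already visited by the path along `l₁`, so it is not a target
    -- within the stretch.
    rw [List.map_cons, hx, List.nodup_cons, hm]
    exact ⟨fun h0 => hn.2.2 _ hs.target_mem _ (List.mem_append_left _ h0) rfl, hn.2.1.1⟩
  · intro v
    by_cases hv : v ∈ F.ext
    · rw [hF] at hv
      rcases List.mem_cons.1 hv with rfl | hv
      · exact List.mem_cons_self
      · obtain rfl := List.mem_singleton.1 hv
        exact List.mem_cons_of_mem _ hym
    · refine List.mem_cons_of_mem _ ?_
      have hne := newNode_ne_oldNode G f (fun _ => F) h (i := ()) hv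
      have := (List.mem_cons.1 (hR.mem_node (newNode G f (fun _ => F) h () v))).resolve_left
        (hne s')
      obtain ⟨⟨e, z⟩, ha, hz⟩ := List.mem_map.1 this
      obtain rfl : z = _ := hz
      have ha' : (e, newNode G f (fun _ => F) h () v) ∈ l₁ ++ l₂ ∨ (e, newNode G f (fun _ => F) h () v) ∈
          List.map (Prod.map (newEdge G f (fun _ => F) h ()) (newNode G f (fun _ => F) h ())) m := by
        simp only [List.mem_append] at ha ⊢
        tauto
      rcases ha' with ha' | ha'
      · obtain ⟨g, hg, hge⟩ := h1 _ ha'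
        obtain rfl : e = _ := hge
        obtain ⟨w, hw⟩ := hR.path.att_eq ha
        have hz : newNode G f (fun _ => F) h () v ∈ (G.att g).map (oldNode G f (fun _ => F) h) := by
          rw [← replace_att_oldEdge G f (fun _ => F) h g hg, hw]
          simp
        obtain ⟨v', -, hv'⟩ := List.mem_map.1 hz
        exact absurd hv'.symm (hne v')
      · obtain ⟨⟨g, v'⟩, hg, hgv⟩ := List.mem_map.1 ha'
        have := newNode_injective G f (fun _ => F) h () (congrArg Prod.snd hgv)
        exact List.mem_map.2 ⟨_, hg, this⟩
  · intro g
    obtain ⟨⟨e, z⟩, ha, hz⟩ := List.mem_map.1 (hR.mem_edge (newEdge G f (fun _ => F) h () g))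
    obtain rfl : e = _ := hz
    have ha' : (newEdge G f (fun _ => F) h () g, z) ∈ l₁ ++ l₂ ∨
        (newEdge G f (fun _ => F) h () g, z) ∈
          List.map (Prod.map (newEdge G f (fun _ => F) h ()) (newNode G f (fun _ => F) h ())) m := by
      simp only [List.mem_append] at ha ⊢
      tauto
    rcases ha' with ha' | ha'
    · obtain ⟨g', hg', hge⟩ := h1 _ ha'
      exact absurd hge.symm (oldEdge_ne_newEdge G f (fun _ => F) h)
    · obtain ⟨⟨g', v'⟩, hg, hgv⟩ := List.mem_map.1 ha'
      have := newEdge_injective G f (fun _ => F) h () (congrArg Prod.fst hgv)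
      exact List.mem_map.2 ⟨_, hg, this⟩
  · simp [word, replace_lab_newEdge]

/-- The edge `g` ends at the external node `t`, hence comes last. Everything before it consists of
edges of `F`, and `inner_of_replace` applies. -/
theorem IsString.of_replace_left {s y t : G.V} {g : G.E}
    (hG : G.IsStringAlong s [(f (), y), (g, t)] t) {w : List C}
    (hR : (G.replace f (fun _ => F) h).IsString w) :
    ∃ u, F.IsString u ∧ w = u ++ [G.lab g] := by
  obtain ⟨a, l, b, hR, rfl⟩ := hR
  obtain ⟨s', t', hext, rfl, rfl⟩ := exists_ext_of_replace hR
  rw [hG.ext_eq] at hext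
  simp only [List.cons.injEq, and_true] at hext
  obtain ⟨rfl, rfl⟩ := hext
  have hgf : g ≠ f () := by
    have := hG.edge_nodup
    simp only [List.map_cons, List.map_nil, List.nodup_cons, List.mem_singleton] at this
    exact Ne.symm this.1
  have hg : g ∉ Set.range f := by rintro ⟨⟨⟩, h0⟩; exact hgf h0.symm
  obtain ⟨l₁, l₂, rfl, h1, h2⟩ := hR.split_edge (e := oldEdge G f (fun _ => F) h g hg)
    (x := oldNode G f (fun _ => F) h y) (y := oldNode G f (fun _ => F) h t) (by
      rw [replace_att_oldEdge, hG.path.2.1]; rfl)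
  have hn := hR.nodup
  simp only [List.map_append, List.map_cons, List.nodup_cons, List.nodup_append] at hn
  -- What follows `g` is a path from `t` to `t`.
  obtain rfl := h2.eq_nil (List.nodup_cons.2 hn.2.2.1)
  have hR' : (G.replace f (fun _ => F) h).IsStringAlong _
    ([] ++ l₁ ++ [(oldEdge G f (fun _ => F) h g hg, oldNode G f (fun _ => F) h t)]) _ := hR
  refine ⟨_, hR'.inner_of_replace hG.path.1 rfl h1 ?_ ?_, ?_⟩
  · intro a ha
    obtain rfl := List.mem_singleton.1 ha
    exact ⟨g, hg, rfl⟩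
  · rintro ⟨e, z⟩ ha
    rcases edge_cases G f (fun _ => F) h e with ⟨e', he', rfl⟩ | ⟨⟨⟩, g', rfl⟩
    · have h3 := hG.mem_edge e'
      simp only [List.map_cons, List.map_nil, List.mem_cons, List.not_mem_nil, or_false] at h3
      rcases h3 with rfl | rfl
      · exact absurd ⟨(), rfl⟩ he'
      · have h4 := hR.edge_nodup
        simp only [List.map_append, List.nodup_append] at h4
        exact absurd rfl (h4.2.2 _ (List.mem_map_of_mem (f := Prod.fst) ha) _ List.mem_cons_self)
    · exact ⟨g', rfl⟩
  · simp [word, replace_lab_oldEdge]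

theorem IsString.of_replace_right {s y t : G.V} {g : G.E}
    (hG : G.IsStringAlong s [(g, y), (f (), t)] t) {w : List C}
    (hR : (G.replace f (fun _ => F) h).IsString w) :
    ∃ u, F.IsString u ∧ w = G.lab g :: u := by
  obtain ⟨a, l, b, hR, rfl⟩ := hR
  obtain ⟨s', t', hext, rfl, rfl⟩ := exists_ext_of_replace hR
  rw [hG.ext_eq] at hext
  simp only [List.cons.injEq, and_true] at hext
  obtain ⟨rfl, rfl⟩ := hext
  have hgf : g ≠ f () := by
    have := hG.edge_nodup
    simp only [List.map_cons, List.map_nil, List.nodup_cons, List.mem_singleton] at this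
    exact this.1
  have hg : g ∉ Set.range f := by rintro ⟨⟨⟩, h0⟩; exact hgf h0.symm
  have hatt : (G.replace f (fun _ => F) h).att (oldEdge G f (fun _ => F) h g hg) =
      [oldNode G f (fun _ => F) h s, oldNode G f (fun _ => F) h y] := by
    rw [replace_att_oldEdge, hG.path.1]
    rfl
  obtain ⟨l₁, l₂, rfl, h1, h2⟩ := hR.split_edge (e := oldEdge G f (fun _ => F) h g hg)
    (x := oldNode G f (fun _ => F) h s) (y := oldNode G f (fun _ => F) h y) hatt
  have hn := hR.nodup
  rw [List.map_append, ← List.cons_append, List.nodup_append] at hn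
  obtain rfl := h1.eq_nil hn.1
  have hR' : (G.replace f (fun _ => F) h).IsStringAlong (oldNode G f (fun _ => F) h s)
    ([(oldEdge G f (fun _ => F) h g hg, oldNode G f (fun _ => F) h y)] ++ l₂ ++ [])
    (oldNode G f (fun _ => F) h t) := by
    simpa using hR
  refine ⟨_, hR'.inner_of_replace hG.path.2.1 ⟨hatt, rfl⟩ h2 ?_ ?_, ?_⟩
  · intro a ha
    obtain rfl := List.mem_singleton.1 ha
    exact ⟨g, hg, rfl⟩
  · rintro ⟨e, z⟩ ha
    rcases edge_cases G f (fun _ => F) h e with ⟨e', he', rfl⟩ | ⟨⟨⟩, g', rfl⟩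
    · have h3 := hG.mem_edge e'
      simp only [List.map_cons, List.map_nil, List.mem_cons, List.not_mem_nil, or_false] at h3
      rcases h3 with rfl | rfl
      · have h4 := hR.edge_nodup
        simp only [List.nil_append, List.map_cons, List.nodup_cons] at h4
        exact absurd (List.mem_map_of_mem (f := Prod.fst) ha) h4.1
      · exact absurd ⟨(), rfl⟩ he'
    · exact ⟨g', rfl⟩
  · simp [word, replace_lab_oldEdge]

/-- Pulls the stretches on either side of the inserted pair back to `G` in
`IsString.of_replace_pair`. -/
theorem exists_pullback_of_replace
    {l : List ((G.replace f (fun _ => F) h).E × (G.replace f (fun _ => F) h).V)}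
    (hl : ∀ a ∈ l, ∃ e he v, a = (oldEdge G f (fun _ => F) h e he, oldNode G f (fun _ => F) h v)) :
    ∃ m : List (G.E × G.V), l.map Prod.snd = (m.map Prod.snd).map (oldNode G f (fun _ => F) h) ∧
      (G.replace f (fun _ => F) h).word l = G.word m ∧
      (∀ e he, oldEdge G f (fun _ => F) h e he ∈ l.map Prod.fst → e ∈ m.map Prod.fst) ∧
      ∀ x y, (G.replace f (fun _ => F) h).Path (oldNode G f (fun _ => F) h x) l
        (oldNode G f (fun _ => F) h y) → G.Path x m y := by
  induction l with
  | nil => exact ⟨[], rfl, rfl, by simp, fun x y hp => oldNode_injective G f _ h hp⟩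
  | cons a l ih =>
    obtain ⟨m, h1, h2, h3, h4⟩ := ih fun b hb => hl b (List.mem_cons_of_mem _ hb)
    obtain ⟨e, he, v, rfl⟩ := hl a List.mem_cons_self
    refine ⟨(e, v) :: m, by simp [h1], ?_, fun e' he' hm => ?_, fun x y hp => ⟨?_, h4 v y hp.2⟩⟩
    · simp only [word, List.map_cons] at h2 ⊢
      rw [h2, replace_lab_oldEdge]
    · rcases List.mem_cons.1 hm with hm | hm
      · exact List.mem_cons.2 (Or.inl ((oldEdge_inj G f _ h).1 hm))
      · exact List.mem_cons_of_mem _ (h3 e' he' hm)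
    · have := hp.1
      rw [replace_att_oldEdge] at this
      exact List.map_injective_iff.2 (oldNode_injective G f _ h) this

/-- The internal node `m` of `F` forces the two inserted edges to be consecutive. Contracting them
to the single edge `f ()` gives a traversal of `G`. -/
theorem IsString.of_replace_pair {a b : C} (hF : F.IsString [a, b]) {w : List C}
    (hR : (G.replace f (fun _ => F) h).IsString w) :
    ∃ w₁ w₂, w = w₁ ++ [a, b] ++ w₂ ∧ G.IsString (w₁ ++ [G.lab (f ())] ++ w₂) := by
  obtain ⟨x, lF, y, hF, hw⟩ := hF
  obtain ⟨⟨e₁, m⟩, ⟨e₂, y'⟩, rfl⟩ := List.length_eq_two.1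
    (by simpa [word] using congrArg List.length hw : lF.length = 2)
  obtain ⟨p, q, hpq⟩ := List.length_eq_two.1 ((h ()).symm.trans hF.type_eq)
  obtain ⟨hp1, hp2, hp3⟩ := hF.path
  obtain rfl : y' = y := hp3
  obtain ⟨hx, hy⟩ := newNode_of_ext G f (fun _ => F) h (i := ()) hF.ext_eq hpq
  simp only [word, List.map_cons, List.map_nil, List.cons.injEq, and_true] at hw
  obtain ⟨rfl, rfl⟩ := hw
  have hm : m ∉ F.ext := by
    have := hF.nodup
    simp only [List.map_cons, List.map_nil, List.nodup_cons, List.mem_cons, not_or,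
      List.not_mem_nil, or_false] at this
    rw [hF.ext_eq]
    simp [this.2.1, Ne.symm this.1.1]
  obtain ⟨s, l, t, hR, rfl⟩ := hR
  obtain ⟨s', t', hext, rfl, rfl⟩ := exists_ext_of_replace hR
  obtain ⟨l₁, l₂, rfl, k1, k2⟩ := hR.split_two_edges (e := newEdge G f (fun _ => F) h () e₁)
    (f := newEdge G f (fun _ => F) h () e₂) (x := oldNode G f (fun _ => F) h p)
    (y := newNode G f (fun _ => F) h () m) (z := oldNode G f (fun _ => F) h q)
    (by rw [replace_att_newEdge, hp1, ← hx]; rfl) (by rw [replace_att_newEdge, hp2, ← hy]; rfl)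
  have hold : ∀ c ∈ l₁ ++ l₂, ∃ e he v,
      c = (oldEdge G f (fun _ => F) h e he, oldNode G f (fun _ => F) h v) := by
    rintro ⟨e, z⟩ hc
    rcases edge_cases G f (fun _ => F) h e with ⟨e, he, rfl⟩ | ⟨⟨⟩, g, rfl⟩
    · have hc' : (oldEdge G f (fun _ => F) h e he, z) ∈ l₁ ++
          (newEdge G f (fun _ => F) h () e₁, newNode G f (fun _ => F) h () m) ::
          (newEdge G f (fun _ => F) h () e₂, oldNode G f (fun _ => F) h q) :: l₂ := by
        simp only [List.mem_append, List.mem_cons] at hc ⊢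
        tauto
      obtain ⟨v, hv⟩ := hR.path.att_eq hc'
      have hz : z ∈ (G.att e).map (oldNode G f (fun _ => F) h) := by
        rw [← replace_att_oldEdge G f (fun _ => F) h e he, hv]
        simp
      obtain ⟨v', -, rfl⟩ := List.mem_map.1 hz
      exact ⟨e, he, v', rfl⟩
    · exfalso
      have hc' : newEdge G f (fun _ => F) h () g ∈ l₁.map Prod.fst ++ l₂.map Prod.fst := by
        rw [← List.map_append]
        exact List.mem_map_of_mem (f := Prod.fst) hc
      have hn := hR.edge_nodup
      have hg := hF.mem_edge g
      simp only [List.map_cons, List.map_nil, List.mem_cons, List.not_mem_nil, or_false] at hg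
      simp only [List.map_append, List.map_cons] at hn
      -- Both inserted edges are moved to the front, so that absence of repetition excludes them
      -- from `l₁` and `l₂`.
      have hn' := (List.perm_middle.trans (List.Perm.cons _ List.perm_middle)).nodup_iff.1 hn
      simp only [List.nodup_cons, List.mem_cons, not_or] at hn'
      rcases hg with rfl | rfl
      · exact hn'.1.2 hc'
      · exact hn'.2.1 hc'
  obtain ⟨m₁, a1, a2, a3, a4⟩ := exists_pullback_of_replace fun c hc =>
    hold c (List.mem_append_left _ hc)
  obtain ⟨m₂, b1, b2, b3, b4⟩ := exists_pullback_of_replace fun c hc =>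
    hold c (List.mem_append_right _ hc)
  refine ⟨G.word m₁, G.word m₂, ?_, s', m₁ ++ (f (), q) :: m₂, t', ⟨path_append.2 ⟨p, a4 _ _ k1, hpq, b4 _ _ k2⟩,
    ?_, ?_, ?_, hext⟩, ?_⟩
  · rw [← a2, ← b2]
    simp [word, replace_lab_newEdge]
  · have hn := hR.nodup
    simp only [List.map_append, List.map_cons, a1, b1] at hn
    -- The old nodes visited form the given traversal with `m` deleted.
    refine List.Nodup.of_map (oldNode G f (fun _ => F) h) (List.Nodup.sublist ?_ hn)
    simp
  · intro v
    have hv := hR.mem_node (oldNode G f (fun _ => F) h v)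
    simp only [List.map_append, List.map_cons, a1, b1, List.mem_cons, List.mem_append,
      (newNode_ne_oldNode G f (fun _ => F) h (i := ()) hm v).symm, false_or,
      (oldNode_injective G f (fun _ => F) h).eq_iff,
      List.mem_map_of_injective (oldNode_injective G f (fun _ => F) h)] at hv
    simpa using hv
  · intro e
    by_cases he : e ∈ Set.range f
    · obtain ⟨⟨⟩, rfl⟩ := he
      simp
    · have hv := hR.mem_edge (oldEdge G f (fun _ => F) h e he)
      simp only [List.map_append, List.map_cons, List.mem_cons, List.mem_append,
        oldEdge_ne_newEdge, false_or] at hv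
      rw [List.map_append, List.map_cons, List.mem_append, List.mem_cons]
      exact hv.imp (a3 e he) fun h0 => Or.inr (b3 e he h0)
  · simp [word]

end Converse

theorem IsString.exists_edge {G : HGraph ty} {w₁ w₂ : List C} {a : C}
    (h : G.IsString (w₁ ++ [a] ++ w₂)) :
    ∃ e s l₁ y l₂ t, G.IsStringAlong s (l₁ ++ (e, y) :: l₂) t ∧ G.word l₁ = w₁ ∧ G.lab e = a ∧
      G.word l₂ = w₂ := by
  obtain ⟨s, l, t, h, hw⟩ := h
  rw [word, List.append_assoc, List.map_eq_append_iff] at hw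
  obtain ⟨l₁, l', rfl, h1, h2⟩ := hw
  obtain ⟨⟨e, y⟩, l₂, rfl, h3, h4⟩ := List.map_eq_cons_iff.1 h2
  exact ⟨e, s, l₁, y, l₂, t, h, h1, h3, h4⟩

/-- External nodes are preserved in order, so the first edge goes to the first and the second to the
second. This separates the two factors of a product in `tr_injective`. -/
theorem str_pair_eq_of_iso {a b a' b' : {c : C // ty c = 2}}
    (h : (str [a, b] (by simp)).Iso (str [a', b'] (by simp))) : a = a' ∧ b = b' := by
  obtain ⟨ν, ε, h1, h2, h3⟩ := h
  change Fin 3 ≃ Fin 3 at ν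
  change Fin 2 ≃ Fin 2 at ε
  have h1' : ∀ e : Fin 2, [(ε e).castSucc, (ε e).succ] = [ν e.castSucc, ν e.succ] := h1
  have h3' : [(0 : Fin 3), 2] = [ν 0, ν 2] := h3
  have h2' : ∀ e : Fin 2, ([a', b'].get (ε e)).1 = ([a, b].get e).1 := h2
  simp only [List.cons.injEq, and_true] at h1' h3'
  have e0 : ε 0 = 0 := by
    have := (h1' 0).1.trans h3'.1.symm
    exact Fin.castSucc_injective 2 this
  have e1 : ε 1 = 1 := by
    have := (h1' 1).2.trans h3'.2.symm
    exact Fin.succ_injective 2 this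
  have k0 := h2' 0
  have k1 := h2' 1
  rw [e0] at k0
  rw [e1] at k1
  exact ⟨Subtype.ext k0.symm, Subtype.ext k1.symm⟩

/-- Replacement of both edges of a string graph of length two. -/
theorem IsStringAlong.replaceAll_pair {M : HGraph ty} {s y t : M.V} {m₁ m₂ : M.E}
    (hM : M.IsStringAlong s [(m₁, y), (m₂, t)] t) {H : M.E → HGraph ty}
    {h : ∀ m, (H m).type = (M.att m).length} {u₁ u₂ : List C} (h₁ : (H m₁).IsString u₁)
    (h₂ : (H m₂).IsString u₂) : (M.replaceAll H h).IsString (u₁ ++ u₂) := by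
  classical
  have hne : m₂ ≠ m₁ := by
    have := hM.edge_nodup
    simp only [List.map_cons, List.map_nil, List.nodup_cons, List.mem_singleton] at this
    exact Ne.symm this.1
  have := IsStringAlong.replace (f := Function.Embedding.refl M.E) (K := H) (h := h) hM
    (fun m => if m = m₁ then u₁ else u₂) (fun m => ?_) (fun m hm => absurd ⟨m, rfl⟩ hm)
  · simpa [HGraph.replaceAll, hne] using this
  · change (H m).IsString (if m = m₁ then u₁ else u₂)
    have hm := hM.mem_edge m
    simp only [List.map_cons, List.map_nil, List.mem_cons, List.not_mem_nil, or_false] at hm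
    rcases hm with rfl | rfl
    · rwa [if_pos rfl]
    · rwa [if_neg hne]

theorem IsString.exists_pair {M : HGraph ty} {a b : C} (h : M.IsString [a, b]) :
    ∃ s m₁ y m₂ t, M.IsStringAlong s [(m₁, y), (m₂, t)] t ∧ M.lab m₁ = a ∧ M.lab m₂ = b := by
  obtain ⟨s, l, t, h, hw⟩ := h
  obtain ⟨⟨e₁, y⟩, ⟨e₂, t'⟩, rfl⟩ := List.length_eq_two.1
    (by simpa [word] using congrArg List.length hw : l.length = 2)
  obtain rfl : t' = t := h.path.2.2
  simp only [word, List.map_cons, List.map_nil, List.cons.injEq, and_true] at hw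
  exact ⟨s, e₁, y, e₂, t', h, hw.1, hw.2⟩

end HGraph

/-! ### Denominators with one `$`-edge and one other edge. -/

namespace Denom

open HGraph

variable {C : Type 1} {ty : C → ℕ}

/-- `D` is isomorphic to `($ b)^•`, where `d` is the edge labelled `b`. -/
def IsLeft (D : Denom ty) (b : C) (d : D.E) : Prop :=
  (∀ d', d' = d) ∧ D.lab d = b ∧
    ∃ s y t : D.V, ∀ a ha,
      IsStringAlong (G := D.fill a ha) s [((none : Option D.E), y), (some d, t)] t

/-- `D` is isomorphic to `(b $)^•`, where `d` is the edge labelled `b`. -/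
def IsRight (D : Denom ty) (b : C) (d : D.E) : Prop :=
  (∀ d', d' = d) ∧ D.lab d = b ∧
    ∃ s y t : D.V, ∀ a ha,
      IsStringAlong (G := D.fill a ha) s [(some d, y), ((none : Option D.E), t)] t

theorem isLeft_dollarLeft (b : {c : C // ty c = 2}) : (dollarLeft b).IsLeft b.1 () := by
  refine ⟨fun _ => rfl, rfl, (0 : Fin 3), (1 : Fin 3), (2 : Fin 3), fun a ha =>
    ⟨⟨rfl, rfl, rfl⟩, ?_, ?_, ?_, rfl⟩⟩
  · exact (by decide : [(0 : Fin 3), 1, 2].Nodup)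
  · exact (by decide : ∀ v : Fin 3, v ∈ [(0 : Fin 3), 1, 2])
  · exact (by decide : ∀ e : Option Unit, e ∈ [none, some ()])

theorem isRight_dollarRight (b : {c : C // ty c = 2}) : (dollarRight b).IsRight b.1 () := by
  refine ⟨fun _ => rfl, rfl, (0 : Fin 3), (1 : Fin 3), (2 : Fin 3), fun a ha =>
    ⟨⟨rfl, rfl, rfl⟩, ?_, ?_, ?_, rfl⟩⟩
  · exact (by decide : [(0 : Fin 3), 1, 2].Nodup)
  · exact (by decide : ∀ v : Fin 3, v ∈ [(0 : Fin 3), 1, 2])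
  · exact (by decide : ∀ e : Option Unit, e ∈ [some (), none])

/-- The `$`-edge starts at the first external node in `($ b)^•` but not in `(b' $)^•`. This keeps
the translations of the two divisions apart. -/
theorem not_dollarLeft_iso_dollarRight (b b' : {c : C // ty c = 2}) :
    ¬ (dollarLeft b).Iso (dollarRight b') := by
  rintro ⟨ν, ε, -, -, h1, h2⟩
  change Fin 3 ≃ Fin 3 at ν
  have h1' : [(0 : Fin 3), 2] = [ν 0, ν 2] := h1
  have h2' : [(1 : Fin 3), 2] = [ν 0, ν 1] := h2
  simp only [List.cons.injEq] at h1' h2'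
  exact absurd (h1'.1.trans h2'.1.symm) (by decide)

theorem Iso.symm {D D' : Denom ty} (h : D.Iso D') : D'.Iso D := by
  obtain ⟨ν, ε, h1, h2, h3, h4⟩ := h
  refine ⟨ν.symm, ε.symm, fun e => ?_, fun e => ?_, by simp [h3], by simp [h4]⟩
  · have := h1 (ε.symm e)
    rw [Equiv.apply_symm_apply] at this
    simp [this]
  · have := h2 (ε.symm e)
    rw [Equiv.apply_symm_apply] at this
    exact this.symm

theorem IsLeft.of_iso {D D' : Denom ty} {b : C} {d : D.E} (h : D.IsLeft b d) (hi : D.Iso D') :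
    ∃ d', D'.IsLeft b d' := by
  obtain ⟨ν, ε, h1, h2, h3, h4⟩ := hi
  obtain ⟨k1, k2, s, y, t, k5⟩ := h
  refine ⟨ε d, fun d' => ?_, (h2 d).trans k2, ν s, ν y, ν t,
    fun a ha => ?_⟩
  · rw [← k1 (ε.symm d'), Equiv.apply_symm_apply]
  · have := (k5 a (by simpa [h4] using ha)).map (G' := D'.fill a ha) ν (Equiv.optionCongr ε)
      (by rintro (_ | e); exacts [h4, h1 e]) h3
    exact this

theorem IsRight.of_iso {D D' : Denom ty} {b : C} {d : D.E} (h : D.IsRight b d) (hi : D.Iso D') :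
    ∃ d', D'.IsRight b d' := by
  obtain ⟨ν, ε, h1, h2, h3, h4⟩ := hi
  obtain ⟨k1, k2, s, y, t, k5⟩ := h
  refine ⟨ε d, fun d' => ?_, (h2 d).trans k2, ν s, ν y, ν t,
    fun a ha => ?_⟩
  · rw [← k1 (ε.symm d'), Equiv.apply_symm_apply]
  · have := (k5 a (by simpa [h4] using ha)).map (G' := D'.fill a ha) ν (Equiv.optionCongr ε)
      (by rintro (_ | e); exacts [h4, h1 e]) h3
    exact this

variable {D : Denom ty} {b : C} {d : D.E}

theorem IsLeft.isString_replace (hD : D.IsLeft b d) {a : C} {ha : ty a = D.att₀.length}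
    {K : D.E → HGraph ty} {hK : ∀ d, (K d).type = (D.att d).length} {u : List C}
    (hu : (K d).IsString u) :
    ((D.fill a ha).replace Function.Embedding.some K hK).IsString ([a] ++ u) := by
  obtain ⟨k1, k2, s, y, t, k5⟩ := hD
  have := IsStringAlong.replace (f := Function.Embedding.some) (K := K) (h := hK) (k5 a ha)
    (fun o => Option.elim o [a] fun _ => u) (fun d' => ?_) (fun e he => ?_)
  · simpa using this
  · obtain rfl := k1 d'
    exact hu
  · rcases e with _ | e
    · rfl
    · exact absurd ⟨e, rfl⟩ he

theorem IsRight.isString_replace (hD : D.IsRight b d) {a : C} {ha : ty a = D.att₀.length}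
    {K : D.E → HGraph ty} {hK : ∀ d, (K d).type = (D.att d).length} {u : List C}
    (hu : (K d).IsString u) :
    ((D.fill a ha).replace Function.Embedding.some K hK).IsString (u ++ [a]) := by
  obtain ⟨k1, k2, s, y, t, k5⟩ := hD
  have := IsStringAlong.replace (f := Function.Embedding.some) (K := K) (h := hK) (k5 a ha)
    (fun o => Option.elim o [a] fun _ => u) (fun d' => ?_) (fun e he => ?_)
  · simpa using this
  · obtain rfl := k1 d'
    exact hu
  · rcases e with _ | e
    · rfl
    · exact absurd ⟨e, rfl⟩ he

theorem IsLeft.isString_replaceOne (hD : D.IsLeft b d) {a : C} {ha : ty a = D.att₀.length}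
    {F : HGraph ty} {hF : F.type = D.att₀.length} {u : List C} (hu : F.IsString u) :
    ((D.fill a ha).replaceOne none F hF).IsString (u ++ [b]) := by
  obtain ⟨k1, k2, s, y, t, k5⟩ := hD
  have := IsStringAlong.replaceOne (l₁ := []) (h := hF) (k5 a ha) hu
  rw [← k2]
  exact this

theorem IsRight.isString_replaceOne (hD : D.IsRight b d) {a : C} {ha : ty a = D.att₀.length}
    {F : HGraph ty} {hF : F.type = D.att₀.length} {u : List C} (hu : F.IsString u) :
    ((D.fill a ha).replaceOne none F hF).IsString ([b] ++ u) := by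
  obtain ⟨k1, k2, s, y, t, k5⟩ := hD
  have := IsStringAlong.replaceOne (G := D.fill a ha) (e := none) (l₁ := [(some d, y)]) (l₂ := [])
    (h := hF) (k5 a ha) hu
  rw [← k2]
  simpa [word, fill] using this

/-- The inversion needed for `(→ ÷)`: the premise is a string graph by induction, and its word must
end in the letter removed by the right rule for `/`. -/
theorem IsLeft.of_isString_replaceOne (hD : D.IsLeft b d) {a : C} {ha : ty a = D.att₀.length}
    {F : HGraph ty} {hF : F.type = D.att₀.length} {w : List C}
    (hw : ((D.fill a ha).replaceOne none F hF).IsString w) :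
    ∃ u, F.IsString u ∧ w = u ++ [b] := by
  obtain ⟨k1, k2, s, y, t, k5⟩ := hD
  obtain ⟨u, h1, h2⟩ := IsString.of_replace_left (G := D.fill a ha)
    (f := ⟨fun _ : Unit => none, fun _ _ _ => rfl⟩) (h := fun _ => hF) (k5 a ha) hw
  exact ⟨u, h1, k2 ▸ h2⟩

theorem IsRight.of_isString_replaceOne (hD : D.IsRight b d) {a : C} {ha : ty a = D.att₀.length}
    {F : HGraph ty} {hF : F.type = D.att₀.length} {w : List C}
    (hw : ((D.fill a ha).replaceOne none F hF).IsString w) :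
    ∃ u, F.IsString u ∧ w = b :: u := by
  obtain ⟨k1, k2, s, y, t, k5⟩ := hD
  obtain ⟨u, h1, h2⟩ := IsString.of_replace_right (G := D.fill a ha)
    (f := ⟨fun _ : Unit => none, fun _ _ _ => rfl⟩) (h := fun _ => hF) (k5 a ha) hw
  exact ⟨u, h1, k2 ▸ h2⟩

end Denom

/-! ### Inversion of the translation and the two simulations. -/

section Translation

open HGraph

variable {Pr : Type} {ar : Pr → ℕ}

theorem tr_type (A : LTp {p : Pr // ar p = 2}) : (tr ar A).type = 2 := (tr₂ ar A).2

theorem tr_over (A B : LTp {p : Pr // ar p = 2}) :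
    tr ar (.over A B) = Tp.div (tr ar A) (Denom.dollarLeft (tr₂ ar B)) (tr_type A) := rfl

theorem tr_under (B A : LTp {p : Pr // ar p = 2}) :
    tr ar (.under B A) = Tp.div (tr ar A) (Denom.dollarRight (tr₂ ar B)) (tr_type A) := rfl

theorem tr_mul (A B : LTp {p : Pr // ar p = 2}) :
    tr ar (.mul A B) = Tp.times (str [tr₂ ar A, tr₂ ar B] (by simp)) := rfl

theorem tr_prim (p : {p : Pr // ar p = 2}) : tr ar (.prim p) = Tp.prim ar p.1 := rfl

theorem tr_injective : Function.Injective (tr ar) := by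
  intro A
  induction A with
  | prim p =>
    rintro (q | ⟨B, A⟩ | ⟨A, B⟩ | ⟨A, B⟩) h <;>
      simp only [tr_prim, tr_under, tr_over, tr_mul] at h
    · exact congrArg _ (Subtype.ext (Tp.prim_inj.1 h))
    · exact (Tp.prim_ne_div h).elim
    · exact (Tp.prim_ne_div h).elim
    · exact (Tp.prim_ne_times h).elim
  | under B A ihB ihA =>
    rintro (q | ⟨B', A'⟩ | ⟨A', B'⟩ | ⟨A', B'⟩) h <;>
      simp only [tr_prim, tr_under, tr_over, tr_mul] at h
    · exact (Tp.prim_ne_div h.symm).elim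
    -- Each denominator has only one edge besides the `$`-edge, so whatever `ε` is, `h2 ()` compares
    -- the two divisor types.
    · obtain ⟨h1, -, ε, -, h2, -, -⟩ := Tp.div_eq_div.1 h
      rw [ihA h1, ihB (h2 ()).symm]
    · exact (Denom.not_dollarLeft_iso_dollarRight _ _ (Tp.div_eq_div.1 h).2.symm).elim
    · exact (Tp.div_ne_times h).elim
  | mul A B ihA ihB =>
    rintro (q | ⟨B', A'⟩ | ⟨A', B'⟩ | ⟨A', B'⟩) h <;>
      simp only [tr_prim, tr_under, tr_over, tr_mul] at h
    · exact (Tp.prim_ne_times h.symm).elim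
    · exact (Tp.div_ne_times h.symm).elim
    · exact (Tp.div_ne_times h.symm).elim
    · obtain ⟨h1, h2⟩ := str_pair_eq_of_iso (Tp.times_eq_times.1 h)
      rw [ihA (congrArg Subtype.val h1), ihB (congrArg Subtype.val h2)]
  -- The remaining constructor is `over`.
  | _ =>
    rename_i A B ihA ihB
    rintro (q | ⟨B', A'⟩ | ⟨A', B'⟩ | ⟨A', B'⟩) h <;>
      simp only [tr_prim, tr_under, tr_over, tr_mul] at h
    · exact (Tp.prim_ne_div h.symm).elim
    · exact (Denom.not_dollarLeft_iso_dollarRight _ _ (Tp.div_eq_div.1 h).2).elim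
    · obtain ⟨h1, -, ε, -, h2, -, -⟩ := Tp.div_eq_div.1 h
      rw [ihA h1, ihB (h2 ()).symm]
    · exact (Tp.div_ne_times h).elim

/-- Types fix `D` only up to isomorphism, which is why its shape is described by `IsLeft` and
`IsRight` and not by equality with `dollarLeft` or `dollarRight`. -/
theorem tr_eq_div {X : LTp {p : Pr // ar p = 2}} {N : Tp ar} {D : Denom (Tp.type (ar := ar))}
    {h : N.type = D.type} (H : Tp.div N D h = tr ar X) :
    ∃ A B d, N = tr ar A ∧
      ((X = .over A B ∧ D.IsLeft (tr ar B) d) ∨ (X = .under B A ∧ D.IsRight (tr ar B) d)) := by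
  rcases X with q | ⟨B, A⟩ | ⟨A, B⟩ | ⟨A, B⟩
  · exact (Tp.prim_ne_div H.symm).elim
  · rw [tr_under] at H
    obtain ⟨h1, h2⟩ := Tp.div_eq_div.1 H
    obtain ⟨d, hd⟩ := (Denom.isRight_dollarRight _).of_iso h2.symm
    exact ⟨A, B, d, h1, Or.inr ⟨rfl, hd⟩⟩
  · rw [tr_over] at H
    obtain ⟨h1, h2⟩ := Tp.div_eq_div.1 H
    obtain ⟨d, hd⟩ := (Denom.isLeft_dollarLeft _).of_iso h2.symm
    exact ⟨A, B, d, h1, Or.inl ⟨rfl, hd⟩⟩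
  · exact (Tp.div_ne_times H).elim

theorem tr_eq_times {X : LTp {p : Pr // ar p = 2}} {M : HGraph (Tp.type (ar := ar))}
    (H : tr ar X = Tp.times M) : ∃ A B, X = .mul A B ∧ M.IsString [tr ar A, tr ar B] := by
  rcases X with q | ⟨B, A⟩ | ⟨A, B⟩ | ⟨A, B⟩
  · exact (Tp.prim_ne_times H).elim
  · rw [tr_under] at H
    exact (Tp.div_ne_times H).elim
  · rw [tr_over] at H
    exact (Tp.div_ne_times H).elim
  · exact ⟨A, B, rfl, (isString_str _ _).of_iso (Tp.times_eq_times.1 H)⟩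

theorem isString_trAnt (Γ : List (LTp {p : Pr // ar p = 2})) (hΓ : Γ ≠ []) :
    (trAnt ar Γ hΓ).IsString (Γ.map (tr ar)) := by
  have := isString_str (Γ.map (tr₂ ar)) (by simpa using hΓ)
  rwa [List.map_map] at this

/-- Allowing any `G` with the right word lets each premise be used on whatever graph a rule of `HL`
produces; `IsString.iso` and the rule `iso` absorb the difference. -/
theorem LDerivable.hlDerivable {Γ : List (LTp {p : Pr // ar p = 2})} {C : LTp {p : Pr // ar p = 2}}
    (hd : LDerivable Γ C) (G : HGraph (Tp.type (ar := ar))) (hG : G.IsString (Γ.map (tr ar))) :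
    HLDerivable G (tr ar C) := by
  induction hd generalizing G with
  | ax p => exact .iso _ _ _ ((isString_handle p.2).iso hG) (.ax p.1)
  | underL Γ Θ Δ A B C hΘ hA hC ihA ihC =>
    have hs := isString_trAnt (ar := ar) (Γ ++ [B] ++ Δ) (by simp)
    simp only [List.map_append] at hs hG
    obtain ⟨e, s, l₁, y, l₂, t, h1, h2, h3, h4⟩ := hs.exists_edge
    have hΘs := isString_trAnt (ar := ar) Θ hΘ
    have hD := (Denom.isRight_dollarRight (tr₂ ar A)).isString_replace
      (a := Tp.div (tr ar B) (Denom.dollarRight (tr₂ ar A)) (tr_type B)) (ha := rfl)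
      (K := fun _ => trAnt ar Θ hΘ) (hK := fun _ => hΘs.type_eq) hΘs
    have hR := h1.replaceOne (h := hD.type_eq.trans (h1.att_length e).symm) hD
    refine .iso _ _ _ (hR.iso ?_) (.divL _ (Denom.dollarRight (tr₂ ar A)) _ _ _ e h3 (fun _ => trAnt ar Θ hΘ)
      (fun _ => hΘs.type_eq) _ (ihC _ (isString_trAnt _ (by simp))) fun _ => ihA _ hΘs)
    simpa [h2, h4, tr_under] using hG
  | underR Θ A B hΘ hB ih =>
    rw [tr_under]
    exact .divR _ _ _ _ hG.type_eq
      (ih _ ((Denom.isRight_dollarRight (tr₂ ar A)).isString_replaceOne hG))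
  | mulL Γ Δ A B C hC ih =>
    simp only [List.map_append] at hG
    obtain ⟨e, s, l₁, y, l₂, t, h1, h2, h3, h4⟩ := hG.exists_edge
    have hs := isString_str [tr₂ ar A, tr₂ ar B] (by simp)
    refine .timesL _ _ _ e h3 (hs.type_eq.trans (h1.att_length e).symm) (ih _ ?_)
    have := h1.replaceOne (h := hs.type_eq.trans (h1.att_length e).symm) hs
    rw [h2, h4] at this
    simpa [tr] using this
  | overL Γ Θ Δ A B C hΘ hA hC ihA ihC =>
    have hs := isString_trAnt (ar := ar) (Γ ++ [B] ++ Δ) (by simp)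
    simp only [List.map_append] at hs hG
    obtain ⟨e, s, l₁, y, l₂, t, h1, h2, h3, h4⟩ := hs.exists_edge
    have hΘs := isString_trAnt (ar := ar) Θ hΘ
    have hD := (Denom.isLeft_dollarLeft (tr₂ ar A)).isString_replace
      (a := Tp.div (tr ar B) (Denom.dollarLeft (tr₂ ar A)) (tr_type B)) (ha := rfl)
      (K := fun _ => trAnt ar Θ hΘ) (hK := fun _ => hΘs.type_eq) hΘs
    have hR := h1.replaceOne (h := hD.type_eq.trans (h1.att_length e).symm) hD
    refine .iso _ _ _ (hR.iso ?_) (.divL _ (Denom.dollarLeft (tr₂ ar A)) _ _ _ e h3 (fun _ => trAnt ar Θ hΘ)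
      (fun _ => hΘs.type_eq) _ (ihC _ (isString_trAnt _ (by simp))) fun _ => ihA _ hΘs)
    simpa [h2, h4, tr_over] using hG
  | overR Θ A B hΘ hB ih =>
    rw [tr_over]
    refine .divR _ _ _ _ hG.type_eq (ih _ ?_)
    rw [List.map_append]
    exact (Denom.isLeft_dollarLeft (tr₂ ar A)).isString_replaceOne hG
  | mulR Θ Ψ A B hΘ hΨ hA hB ihA ihB =>
    classical
    have hM := isString_str [tr₂ ar A, tr₂ ar B] (by simp)
    obtain ⟨s, m₁, y, m₂, t, hM, h1, h2⟩ := IsString.exists_pair hM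
    have hΘs := isString_trAnt (ar := ar) Θ hΘ
    have hΨs := isString_trAnt (ar := ar) Ψ hΨ
    have hne : m₂ ≠ m₁ := by
      have := hM.edge_nodup
      simp only [List.map_cons, List.map_nil, List.nodup_cons, List.mem_singleton] at this
      exact Ne.symm this.1
    let H : (str [tr₂ ar A, tr₂ ar B] (by simp)).E → HGraph (Tp.type (ar := ar)) := fun m =>
      if m = m₁ then trAnt ar Θ hΘ else trAnt ar Ψ hΨ
    have H1 : H m₁ = trAnt ar Θ hΘ := if_pos rfl
    have H2 : H m₂ = trAnt ar Ψ hΨ := if_neg hne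
    have hcase : ∀ m, m = m₁ ∨ m = m₂ := fun m => by
      have := hM.mem_edge m
      simpa only [List.map_cons, List.map_nil, List.mem_cons, List.not_mem_nil, or_false] using this
    have hH : ∀ m, (H m).type = ((str [tr₂ ar A, tr₂ ar B] (by simp)).att m).length := by
      intro m
      rw [hM.att_length]
      rcases hcase m with rfl | rfl
      · rw [H1, hΘs.type_eq]
      · rw [H2, hΨs.type_eq]
    have hR := hM.replaceAll_pair (h := hH) (H1 ▸ hΘs) (H2 ▸ hΨs)
    rw [List.map_append] at hG
    refine .iso _ _ _ (hR.iso hG) (.timesR _ _ _ fun m => ?_)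
    rcases hcase m with rfl | rfl
    · rw [H1, h1]
      exact ihA _ hΘs
    · rw [H2, h2]
      exact ihB _ hΨs

/-- In each rule, the labels of the premises are shown to be translated types, and the words
supplied by induction are then matched with the corresponding rule of `L`. -/
theorem HLDerivable.exists_lDerivable {G : HGraph (Tp.type (ar := ar))} {T : Tp ar}
    (hd : HLDerivable G T) (hG : ∀ e, G.lab e ∈ Set.range (tr ar))
    (C : LTp {p : Pr // ar p = 2}) (hC : T = tr ar C) :
    ∃ Γ : List (LTp {p : Pr // ar p = 2}), G.IsString (Γ.map (tr ar)) ∧ LDerivable Γ C := by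
  induction hd generalizing C with
  | ax p =>
    rcases C with q | ⟨B, A⟩ | ⟨A, B⟩ | ⟨A, B⟩
    · obtain rfl := Tp.prim_inj.1 hC
      exact ⟨[.prim q], isString_handle q.2, .ax q⟩
    · rw [tr_under] at hC
      exact (Tp.prim_ne_div hC).elim
    · rw [tr_over] at hC
      exact (Tp.prim_ne_div hC).elim
    · exact (Tp.prim_ne_times hC).elim
  | divL N D hND H T e he K hK hDe hH hKd ihH ihK =>
    let R := (D.fill (Tp.div N D hND) rfl).replace Function.Embedding.some K hK
    have hnew : ∀ g, R.lab g ∈ Set.range (tr ar) := fun g =>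
      hG (newEdge H ⟨fun _ : Unit => e, fun _ _ _ => rfl⟩ (fun _ => R) (fun _ => hDe) () g)
    have hKlab : ∀ d g, (K d).lab g ∈ Set.range (tr ar) := fun d g =>
      hnew (newEdge (D.fill (Tp.div N D hND) rfl) Function.Embedding.some K hK d g)
    -- The `$`-edge survives in the conclusion with label `N ÷ D`, so this type is a translation,
    -- and with it `N` and the other label of `D`.
    obtain ⟨X, hX⟩ := hnew (oldEdge (D.fill (Tp.div N D hND) rfl) Function.Embedding.some K hK
      none (fun ⟨_, h0⟩ => Option.some_ne_none _ h0))
    obtain ⟨A, B, d, hN, hcase⟩ := tr_eq_div (X := X) (N := N) (D := D) (h := hND) hX.symm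
    -- Every edge of `H` except `e` survives in the conclusion, and `e` carries `N`.
    obtain ⟨Γ, hΓ, hΓC⟩ := ihH (fun g => by
      by_cases hg : g = e
      · rw [hg, he, hN]
        exact ⟨A, rfl⟩
      · exact hG (oldEdge H ⟨fun _ : Unit => e, fun _ _ _ => rfl⟩ (fun _ => R) (fun _ => hDe) g
          (fun ⟨_, h0⟩ => hg h0.symm))) C hC
    obtain ⟨s, l, t, hl, hw⟩ := hΓ
    obtain ⟨l₁, y, l₂, rfl⟩ := hl.exists_split e
    simp only [word, List.map_append, List.map_cons] at hw
    obtain ⟨Γ₁, Γ', rfl, h1, h2⟩ := List.map_eq_append_iff.1 hw.symm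
    obtain ⟨A', Γ₂, rfl, h3, h4⟩ := List.map_eq_cons_iff.1 h2
    obtain rfl : A' = A := tr_injective (h3.trans (he.trans hN))
    rcases hcase with ⟨rfl, hD⟩ | ⟨rfl, hD⟩
    · obtain ⟨Θ, hΘ, hΘB⟩ := ihK d (hKlab d) B hD.2.1
      have hΘ0 : Θ ≠ [] := by simpa using hΘ.ne_nil
      refine ⟨Γ₁ ++ [.over A' B] ++ Θ ++ Γ₂, ?_, .overL _ _ _ _ _ _ hΘ0 hΘB (by simpa using hΓC)⟩
      have := hl.replaceOne (h := hDe) (hD.isString_replace hΘ)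
      simp only [word, ← h1, ← h4] at this
      have hX' : Tp.div N D hND = tr ar (.over A' B) := hX.symm
      simpa [hX'] using this
    · obtain ⟨Θ, hΘ, hΘB⟩ := ihK d (hKlab d) B hD.2.1
      have hΘ0 : Θ ≠ [] := by simpa using hΘ.ne_nil
      refine ⟨Γ₁ ++ Θ ++ [.under B A'] ++ Γ₂, ?_, .underL _ _ _ _ _ _ hΘ0 hΘB (by simpa using hΓC)⟩
      have := hl.replaceOne (h := hDe) (hD.isString_replace hΘ)
      simp only [word, ← h1, ← h4] at this
      have hX' : Tp.div N D hND = tr ar (.under B A') := hX.symm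
      simpa [hX'] using this
  | divR N D hND F hF hd ih =>
    obtain ⟨A, B, d, hN, hcase⟩ := tr_eq_div hC
    have hdlab : D.lab d = tr ar B := by
      rcases hcase with ⟨-, hD⟩ | ⟨-, hD⟩ <;> exact hD.2.1
    have huniq : ∀ d', d' = d := by
      rcases hcase with ⟨-, hD⟩ | ⟨-, hD⟩ <;> exact hD.1
    -- The `$`-edge has been replaced, so the premise has only the label of `d` besides those of
    -- `F`.
    obtain ⟨Γ, hΓ, hΓC⟩ := ih (fun g => by
      rcases g with ⟨g, hg⟩ | ⟨⟨⟩, g⟩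
      · rcases g with _ | d'
        · exact absurd ⟨(), rfl⟩ hg
        · obtain rfl := huniq d'
          exact ⟨B, hdlab.symm⟩
      · exact hG g) A hN
    rcases hcase with ⟨rfl, hD⟩ | ⟨rfl, hD⟩
    · obtain ⟨u, hu, hw⟩ := hD.of_isString_replaceOne hΓ
      obtain ⟨Θ, Γ', rfl, rfl, h2⟩ := List.map_eq_append_iff.1 hw
      obtain ⟨B', Γ'', rfl, h3, h4⟩ := List.map_eq_cons_iff.1 h2
      obtain rfl := List.map_eq_nil_iff.1 h4
      obtain rfl := tr_injective h3
      exact ⟨Θ, hu, .overR _ _ _ (by simpa using hu.ne_nil) hΓC⟩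
    · obtain ⟨u, hu, hw⟩ := hD.of_isString_replaceOne hΓ
      obtain ⟨B', Θ, rfl, h3, rfl⟩ := List.map_eq_cons_iff.1 hw
      obtain rfl := tr_injective h3
      exact ⟨Θ, hu, .underR _ _ _ (by simpa using hu.ne_nil) hΓC⟩
  | timesL F G T e he hF hd ih =>
    obtain ⟨X, hX⟩ := hG e
    obtain ⟨A, B, rfl, hFs⟩ := tr_eq_times (hX.trans he)
    obtain ⟨s, m₁, y, m₂, t, hM, h1, h2⟩ := IsString.exists_pair hFs
    obtain ⟨Γ, hΓ, hΓC⟩ := ih (fun g => by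
      rcases g with ⟨g, hg⟩ | ⟨⟨⟩, g⟩
      · exact hG g
      · change F.lab g ∈ _
        have hm := hM.mem_edge g
        simp only [List.map_cons, List.map_nil, List.mem_cons, List.not_mem_nil, or_false] at hm
        rcases hm with rfl | rfl
        · exact ⟨A, h1.symm⟩
        · exact ⟨B, h2.symm⟩) C hC
    obtain ⟨w₁, w₂, hw, hGs⟩ := IsString.of_replace_pair
      (f := ⟨fun _ => e, fun _ _ _ => rfl⟩) (h := fun _ => hF) hFs hΓ
    obtain ⟨Γ', Δ, rfl, h3, rfl⟩ := List.map_eq_append_iff.1 hw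
    obtain ⟨Γ, Γ'', rfl, rfl, h4⟩ := List.map_eq_append_iff.1 h3
    -- The word only gives the translations of the two letters; injectivity of `tr` recovers the
    -- types of `L`.
    obtain rfl : Γ'' = [A, B] := List.map_injective_iff.2 tr_injective h4
    refine ⟨Γ ++ [.mul A B] ++ Δ, ?_, .mulL _ _ _ _ _ hΓC⟩
    simp only [List.map_append, List.map_cons, List.map_nil, hX]
    exact hGs
  | timesR M H hH hd ih =>
    obtain ⟨A, B, rfl, hMs⟩ := tr_eq_times hC.symm
    obtain ⟨s, m₁, y, m₂, t, hM, h1, h2⟩ := IsString.exists_pair hMs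
    have hlab : ∀ m g, (H m).lab g ∈ Set.range (tr ar) := fun m g =>
      hG (newEdge M (Function.Embedding.refl M.E) H hH m g)
    obtain ⟨Θ, hΘ, hΘA⟩ := ih m₁ (hlab m₁) A h1
    obtain ⟨Ψ, hΨ, hΨB⟩ := ih m₂ (hlab m₂) B h2
    refine ⟨Θ ++ Ψ, ?_, .mulR _ _ _ _ (by simpa using hΘ.ne_nil) (by simpa using hΨ.ne_nil)
      hΘA hΨB⟩
    rw [List.map_append]
    exact hM.replaceAll_pair hΘ hΨ
  | iso G G' T hi hd ih =>
    obtain ⟨Γ, hΓ, hΓC⟩ := ih (fun e => by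
      obtain ⟨ν, ε, -, h2, -⟩ := hi
      rw [← h2]
      exact hG _) C hC
    exact ⟨Γ, hΓ.of_iso hi, hΓC⟩

end Translation

theorem mainTheorem2 {Pr : Type} (ar : Pr → ℕ) :
    (∀ (Γ : List (LTp {p : Pr // ar p = 2})) (hΓ : Γ ≠ []) (C : LTp {p : Pr // ar p = 2}),
      LDerivable Γ C → HLDerivable (trAnt ar Γ hΓ) (tr ar C)) ∧
    (∀ (G : HGraph (Tp.type (ar := ar))) (T : Tp ar),
      (∀ e, G.lab e ∈ Set.range (tr ar)) → T ∈ Set.range (tr ar) → HLDerivable G T →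
      ∃ (Γ : List (LTp {p : Pr // ar p = 2})) (hΓ : Γ ≠ []) (C : LTp {p : Pr // ar p = 2}),
        G.Iso (trAnt ar Γ hΓ) ∧ T = tr ar C ∧ LDerivable Γ C) := by
  refine ⟨fun Γ hΓ C hd => hd.hlDerivable _ (isString_trAnt Γ hΓ), ?_⟩
  rintro G _ hG ⟨C, rfl⟩ hd
  obtain ⟨Γ, hΓ, hΓC⟩ := hd.exists_lDerivable hG C rfl
  have hΓ0 : Γ ≠ [] := by simpa using hΓ.ne_nil
  exact ⟨Γ, hΓ0, C, hΓ.iso (isString_trAnt Γ hΓ0), rfl, hΓC⟩
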